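/- A Noetherian local ring $(R,\mathfrak m)$ is called an almost complete intersection if $R\cong A/\mathfrak a$ for some regular local ring $A$ and some ideal $\mathfrak a$ of $A$ whose minimal number of generators is $\operatorname{ht}(\mathfrak a)+1$. For a Noetherian local ring $R$ of dimension $d$ with a system of parameters $\mathbf x=x_1,\dots,x_d$, let $$e(\mathbf x,R)=\lim_{n\to\infty} d!\,\frac{\ell_R\big(R/(\mathbf x)^n\big)}{n^d}$$ be the Hilbert–Samuel multiplicity of $R$ with respect to the ideal $(\mathbf x)$, and let $\operatorname{embdim}R$ be the minimal number of generators of $\mathfrak m$. **Proposition.** Let $(R,\mathfrak m)$ be an almost complete intersection of dimension $d$ and let $\mathbf x=x_1,\dots,x_d$ be a system of parameters of $R$ such that $\mathfrak m^2\subseteq(\mathbf x)$ and such that $\mathbf x$ is part of a minimal generating set of $\mathfrak m$. Then $\operatorname{embdim}R-\dim R\le 2$. Moreover, the limit defining $e(\mathbf x,R)$ exists, and either $R$ is Cohen–Macaulay and $e(\mathbf x,R)=3$, or $e(\mathbf x,R)\le 2$. -/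

import Mathlib

universe u v

open IsLocalRing

namespace AlmostCI

/-- A commutative ring `R` is an almost complete intersection if it is a residue ring `A ⧸ 𝔞` of a
regular local ring `A` by an ideal `𝔞` whose minimal number of generators is `height 𝔞 + 1`. -/
def IsAlmostCompleteIntersection (R : Type u) [CommRing R] : Prop :=
  ∃ (A : Type v) (_ : CommRing A) (_ : IsRegularLocalRing A) (𝔞 : Ideal A),
    Nonempty (R ≃+* A ⧸ 𝔞) ∧ (𝔞.spanFinrank : ℕ∞) = 𝔞.height + 1

/-- `x₁, …, x_d` is a system of parameters of the local ring `R`: its length is `dim R` and it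
generates an ideal that is primary to the maximal ideal. -/
def IsSystemOfParameters {R : Type u} [CommRing R] [IsLocalRing R] {d : ℕ} (x : Fin d → R) :
    Prop :=
  ringKrullDim R = d ∧ (Ideal.span (Set.range x)).radical = maximalIdeal R

/-- The elements `x₁, …, x_d` are distinct and belong to a common minimal (that is, irredundant)
generating set of the ideal `I`. -/
def IsPartOfMinimalGeneratingSet {R : Type u} [CommRing R] {d : ℕ} (x : Fin d → R)
    (I : Ideal R) : Prop :=
  Function.Injective x ∧
    ∃ S : Set R, Set.range x ⊆ S ∧ Minimal (fun T : Set R => Ideal.span T = I) S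

/-- The embedding dimension: the minimal number of generators of the maximal ideal. -/
noncomputable def embdim (R : Type u) [CommRing R] [IsLocalRing R] : ℕ :=
  (maximalIdeal R).spanFinrank

/-- The depth of a local ring: the supremum of the lengths of the regular sequences contained in
the maximal ideal. -/
noncomputable def depth (R : Type u) [CommRing R] [IsLocalRing R] : ℕ∞ :=
  ⨆ (rs : List R) (_ : (∀ r ∈ rs, r ∈ maximalIdeal R) ∧ RingTheory.Sequence.IsRegular R rs),
    (rs.length : ℕ∞)

/-- A (Noetherian) local ring is Cohen–Macaulay if its depth equals its Krull dimension. -/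
def IsCohenMacaulay (R : Type u) [CommRing R] [IsLocalRing R] : Prop :=
  (depth R : WithBot ℕ∞) = ringKrullDim R

/-- The Krull dimension as a natural number, for rings of finite dimension (in particular for
Noetherian local rings). -/
noncomputable def natDim (R : Type u) [CommRing R] : ℕ :=
  ((ringKrullDim R).unbotD 0).toNat

/-- The sequence `n ↦ d! · ℓ_R(R ⧸ 𝔮ⁿ) / nᵈ`, where `d = dim R`. For a Noetherian local ring and
an ideal `𝔮` primary to the maximal ideal, all the lengths with `n ≥ 1` are finite. -/
noncomputable def hilbertSamuelSeq {R : Type u} [CommRing R] (q : Ideal R) (n : ℕ) : ℝ :=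
  (natDim R).factorial * ((Module.length R (R ⧸ q ^ n)).toNat : ℝ) / (n : ℝ) ^ natDim R

/-- The Hilbert–Samuel multiplicity `e(𝔮, R) = lim d! · ℓ_R(R ⧸ 𝔮ⁿ) / nᵈ`. -/
noncomputable def hilbertSamuelMultiplicity {R : Type u} [CommRing R] (q : Ideal R) : ℝ :=
  Filter.limUnder Filter.atTop (hilbertSamuelSeq q)

end AlmostCI

/-!
Write `k = embdim R - d` and `R = A / 𝔞` with `A` regular local and `𝔞` generated by `ht 𝔞 + 1`
elements.

**Embedding dimension.** Modulo the lifts of `x` and those generators of `𝔞` that are needed to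
complete lifts of generators of `𝔪_R` to a regular system of parameters of `A`, the ring `A` becomes
a regular local ring of dimension `k` in which `𝔞` generates the square of the maximal ideal. Since
`ht 𝔞 ≤ dim A - d`, at most `k + 1` generators of `𝔞` are left. In a regular local ring the
`k (k + 1) / 2` quadratic monomials in the parameters are independent modulo `𝔪 ^ 3`
(`mem_maximalIdeal_of_sum_mul_mem`), because ideals generated by parameters are prime
(`isPrime_span_image`). Hence `k ≤ 2` (`card_le_two_of_irredundant`).

**Multiplicity.** Order the monomials `x ^ a` degree-lexicographically and let `L_a` be the ideal of
all `r` such that `r x ^ a` is a combination of larger monomials (`leadingIdeal`). Then `(x) ⊆ L_a`,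
the ideals `L_a` increase with `a`, and `ℓ(R / (x) ^ n)` is the sum of `ℓ(R / L_a)` over the
exponents of degree less than `n` (`length_quotient_pow`). The function `a ↦ ℓ(R / L_a)` is antitone
with values in `ℕ`, so it equals its minimum at every exponent beyond some `a₀`, hence at almost all
exponents; therefore the limit exists and is this minimum (`exists_tendsto_hilbertSamuelSeq`).

**Conclusion.** As `𝔪 ^ 2 ⊆ (x)`, the length of `R / (x)` is at most `1 + k ≤ 3`, which bounds the
multiplicity. If the multiplicity is `3`, every `L_a` equals `(x)`; then `x` is quasi-regular
(`coeff_mem_of_sum_mem_pow`), and by Krull's intersection theorem it is a regular sequence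
(`isRegular_ofFn_of_leadingIdeal_eq`), so `R` is Cohen–Macaulay.
-/

namespace AlmostCI

/-! ### Irredundant generators of the maximal ideal -/

/-- A family in a commutative ring is irredundant if no member lies in the ideal generated by the
members at the other indices. -/
def Irredundant {R ι : Type*} [CommRing R] (z : ι → R) : Prop :=
  ∀ i, z i ∉ Ideal.span (z '' {i}ᶜ)

section Irredundant

variable {A ι : Type*} [CommRing A] [IsLocalRing A] [Fintype ι] {z : ι → A}

/-- An irredundant family of generators of `𝔪` is linearly independent modulo `𝔪 ^ 2`. -/
lemma Irredundant.mem_maximalIdeal_of_sum_mem (hz : Irredundant z)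
    (hspan : Ideal.span (Set.range z) = maximalIdeal A) {u : ι → A}
    (hu : ∑ i, u i * z i ∈ maximalIdeal A ^ 2) (i : ι) : u i ∈ maximalIdeal A := by
  classical
  have h2 : ∑ i, u i * z i ∈ maximalIdeal A • Ideal.span (Set.range z) := by
    rwa [hspan, smul_eq_mul, ← pow_two]
  obtain ⟨c, hc, hcu⟩ : ∃ c : ι → A, (∀ i, c i ∈ maximalIdeal A) ∧
      ∑ i, c i * z i = ∑ i, u i * z i := by
    obtain ⟨a, ha, h⟩ := (Submodule.mem_ideal_smul_span_iff_exists_sum _ _ _).1 h2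
    refine ⟨a, ha, ?_⟩
    rw [← h, Finsupp.sum_fintype _ _ (by simp)]
    simp
  by_contra hui
  have hunit : IsUnit (u i - c i) := by
    by_contra hn
    exact hui (by simpa using add_mem ((mem_maximalIdeal _).2 hn) (hc i))
  have hrel : (u i - c i) * z i = -∑ j ∈ Finset.univ.erase i, (u j - c j) * z j := by
    have : ∑ j, (u j - c j) * z j = 0 := by
      simp [sub_mul, Finset.sum_sub_distrib, hcu]
    rw [← Finset.add_sum_erase _ _ (Finset.mem_univ i)] at this
    exact eq_neg_of_add_eq_zero_left this
  refine hz i ((Ideal.unit_mul_mem_iff_mem _ hunit).1 ?_)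
  rw [hrel]
  refine neg_mem (sum_mem fun j hj => Ideal.mul_mem_left _ _ (Ideal.subset_span ?_))
  exact ⟨j, by simpa using (Finset.mem_erase.1 hj).1, rfl⟩

lemma Irredundant.mem_maximalIdeal_of_mul_mem (hz : Irredundant z)
    (hspan : Ideal.span (Set.range z) = maximalIdeal A) {T : Set ι} {i : ι} (hi : i ∉ T)
    {u : A} (hu : u * z i ∈ Ideal.span (z '' T) ⊔ maximalIdeal A ^ 2) : u ∈ maximalIdeal A := by
  classical
  obtain ⟨a, ha, b, hb, hab⟩ := Submodule.mem_sup.1 hu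
  have := Fintype.ofFinite T
  rw [← Set.coe_toFinset T] at ha
  obtain ⟨c, rfl⟩ := (Submodule.mem_span_image_finset_iff_exists_fun' A).1 ha
  have h := hz.mem_maximalIdeal_of_sum_mem hspan
    (u := fun j => (if j = i then u else 0) - if j ∈ T.toFinset then c j else 0) (by
      simp only [sub_mul, ite_mul, zero_mul, Finset.sum_sub_distrib, Finset.sum_ite_eq',
        Finset.mem_univ, if_true, Finset.sum_ite_mem, Finset.univ_inter]
      rwa [← hab, show (∑ i ∈ T.toFinset, c i * z i) = ∑ i ∈ T.toFinset, c i • z i from rfl,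
        add_sub_cancel_left]) i
  simpa [hi] using h

lemma Irredundant.card_eq_spanFinrank [IsNoetherianRing A] (hz : Irredundant z)
    (hspan : Ideal.span (Set.range z) = maximalIdeal A) :
    Fintype.card ι = (maximalIdeal A).spanFinrank := by
  classical
  have hm : ∀ i, z i ∈ maximalIdeal A := fun i => hspan ▸ Ideal.subset_span ⟨i, rfl⟩
  let w : ι → maximalIdeal A := fun i => ⟨z i, hm i⟩
  let v : ι → CotangentSpace A := fun i => (maximalIdeal A).toCotangent (w i)
  have hli : LinearIndependent (ResidueField A) v := by
    rw [Fintype.linearIndependent_iff]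
    intro g hg i
    choose u hu using fun i => residue_surjective (g i)
    have h0 : (maximalIdeal A).toCotangent (∑ i, u i • w i) = 0 := by
      rw [map_sum, ← hg]
      refine Finset.sum_congr rfl fun i _ => ?_
      rw [map_smul, ← hu i]
      rfl
    rw [Ideal.toCotangent_eq_zero] at h0
    rw [← hu i, residue_eq_zero_iff]
    exact hz.mem_maximalIdeal_of_sum_mem hspan (u := u) (by simpa [w] using h0) i
  have hsp : ⊤ ≤ Submodule.span (ResidueField A) (Set.range v) := by
    have hr : Set.range v = (maximalIdeal A).toCotangent '' Set.range w := by
      rw [← Set.range_comp]; rfl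
    rw [hr, CotangentSpace.span_image_eq_top_iff.2]
    refine Submodule.map_injective_of_injective (Submodule.injective_subtype _) ?_
    rw [Submodule.map_span, ← Set.range_comp]
    rw [Submodule.map_top, Submodule.range_subtype]
    exact hspan
  rw [spanFinrank_maximalIdeal_eq_finrank_cotangentSpace,
    Module.finrank_eq_card_basis (Module.Basis.mk hli hsp)]

lemma irredundant_of_card_eq_spanFinrank
    (hspan : Ideal.span (Set.range z) = maximalIdeal A)
    (hcard : Fintype.card ι = (maximalIdeal A).spanFinrank) : Irredundant z := by
  classical
  intro i hi
  have hle : Ideal.span (z '' {i}ᶜ) = maximalIdeal A := by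
    refine le_antisymm (hspan ▸ Ideal.span_mono (Set.image_subset_range _ _)) ?_
    rw [← hspan, Ideal.span_le]
    rintro _ ⟨j, rfl⟩
    by_cases hj : j = i
    · exact hj ▸ hi
    · exact Ideal.subset_span ⟨j, hj, rfl⟩
  have h1 := Submodule.spanFinrank_span_le_ncard_of_finite (R := A)
    ((Set.toFinite ({i}ᶜ : Set ι)).image z)
  rw [show Submodule.span A (z '' {i}ᶜ) = maximalIdeal A from hle, ← hcard] at h1
  have h2 := Set.ncard_image_le (f := z) (Set.toFinite ({i}ᶜ : Set ι))
  have h3 : ({i}ᶜ : Set ι).ncard = Fintype.card ι - 1 := by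
    rw [Set.ncard_compl, Set.ncard_singleton, Nat.card_eq_fintype_card]
  have : 0 < Fintype.card ι := Fintype.card_pos_iff.2 ⟨i⟩
  omega

end Irredundant

/-! ### Regular local rings are domains -/

/-- Dividing a regular local ring by part of a system of generators of `𝔪` of the least size lowers
both the dimension and the number of generators of `𝔪` by the number of elements divided out. -/
lemma isRegularLocalRing_quotient_span {A : Type*} [CommRing A] [IsRegularLocalRing A]
    (t s : Finset A) (h : Ideal.span (t ∪ s : Set A) = maximalIdeal A)
    (hcard : t.card + s.card ≤ (maximalIdeal A).spanFinrank) :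
    ∃ _ : IsRegularLocalRing (A ⧸ Ideal.span (t : Set A)),
      (maximalIdeal (A ⧸ Ideal.span (t : Set A))).spanFinrank ≤ s.card := by
  classical
  have hle : Ideal.span (t : Set A) ≤ maximalIdeal A := h ▸ Ideal.span_mono Set.subset_union_left
  have : Nontrivial (A ⧸ Ideal.span (t : Set A)) :=
    Ideal.Quotient.nontrivial_iff.2 (ne_top_of_le_ne_top Ideal.IsPrime.ne_top' hle)
  have : IsLocalRing (A ⧸ Ideal.span (t : Set A)) :=
    .of_surjective' _ (Ideal.Quotient.mk_surjective)
  have hmap : maximalIdeal (A ⧸ Ideal.span (t : Set A)) =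
      Ideal.span (Ideal.Quotient.mk (Ideal.span (t : Set A)) '' s) := by
    have h1 : maximalIdeal (A ⧸ Ideal.span (t : Set A)) =
        (maximalIdeal A).map (Ideal.Quotient.mk (Ideal.span (t : Set A))) := by
      rw [← IsLocalRing.map_maximalIdeal_of_surjective _ Ideal.Quotient.mk_surjective]
    rw [h1, ← h, Ideal.span_union, Ideal.map_sup, Ideal.map_quotient_self, bot_sup_eq,
      Ideal.map_span]
  have h1 : (maximalIdeal (A ⧸ Ideal.span (t : Set A))).spanFinrank ≤ s.card := by
    rw [hmap]
    refine (Submodule.spanFinrank_span_le_ncard_of_finite (s.finite_toSet.image _)).trans ?_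
    exact (Set.ncard_image_le s.finite_toSet).trans (by simp)
  refine ⟨IsRegularLocalRing.of_spanFinrank_maximalIdeal_le _ ?_, h1⟩
  have h2 := ringKrullDim_le_ringKrullDim_quotient_add_card t
    (by rw [IsLocalRing.ringJacobson_eq_maximalIdeal]; exact Ideal.span_le.1 hle)
  rw [← IsRegularLocalRing.spanFinrank_maximalIdeal] at h2
  have h3 : ringKrullDim (A ⧸ Ideal.span (t : Set A)) ≠ ⊥ := ringKrullDim_ne_bot
  generalize ringKrullDim (A ⧸ Ideal.span (t : Set A)) = D at *
  induction D with
  | bot => exact absurd rfl h3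
  | coe D =>
    induction D with
    | top => exact le_top
    | coe D =>
      norm_cast at h2 ⊢
      omega

theorem isDomain_of_isRegularLocalRing (A : Type*) [CommRing A] [IsRegularLocalRing A] :
    IsDomain A := by
  classical
  obtain ⟨n, hn⟩ : ∃ n, (maximalIdeal A).spanFinrank ≤ n := ⟨_, le_rfl⟩
  induction n generalizing A with
  | zero =>
    have hbot : maximalIdeal A = ⊥ :=
      (Submodule.spanFinrank_eq_zero_iff_eq_bot (maximalIdeal A).fg_of_isNoetherianRing).1
        (Nat.le_zero.1 hn)
    exact ((IsLocalRing.isField_iff_maximalIdeal_eq).2 hbot).isDomain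
  | succ n ih =>
    by_cases hbot : maximalIdeal A = ⊥
    · exact ((IsLocalRing.isField_iff_maximalIdeal_eq).2 hbot).isDomain
    have hdim := IsRegularLocalRing.spanFinrank_maximalIdeal (R := A)
    -- prime avoidance, which allows the ideal `𝔪 ^ 2` beside the minimal primes
    obtain ⟨y, hym, hy2, hyp⟩ : ∃ y ∈ maximalIdeal A, y ∉ maximalIdeal A ^ 2 ∧
        ∀ p ∈ minimalPrimes A, y ∉ p := by
      by_contra! hcon
      have hfin := minimalPrimes.finite_of_isNoetherianRing A
      have hsub := (Ideal.subset_union_prime (s := insert (maximalIdeal A ^ 2) hfin.toFinset)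
        (f := id) (maximalIdeal A ^ 2) (maximalIdeal A ^ 2) (fun p hp h _ => by
          have hp' : p ∈ minimalPrimes A := by simpa [h] using hp
          exact hp'.1.1) (I := maximalIdeal A)).1 (fun y hy => by
          simp only [Set.mem_iUnion]
          by_cases h : y ∈ maximalIdeal A ^ 2
          · exact ⟨_, by simp, h⟩
          · obtain ⟨p, hp, hyp⟩ := hcon y hy h
            exact ⟨p, by simp [hp], hyp⟩)
      obtain ⟨p, hp, hle⟩ := hsub
      rw [id] at hle
      rcases Finset.mem_insert.1 hp with rfl | hp
      · refine hbot ?_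
        refine Submodule.eq_bot_of_le_smul_of_le_jacobson_bot (maximalIdeal A) _
          (maximalIdeal A).fg_of_isNoetherianRing ?_ (maximalIdeal_le_jacobson _)
        rwa [smul_eq_mul, ← pow_two]
      · have hp' : p ∈ minimalPrimes A := by simpa using hp
        have : p.IsPrime := hp'.1.1
        have hpm : p = maximalIdeal A := le_antisymm (le_maximalIdeal this.ne_top) hle
        have h0 : (maximalIdeal A).height = 0 := by
          rw [← hpm]
          exact Ideal.height_eq_zero_iff.2 hp'
        rw [← maximalIdeal_height_eq_ringKrullDim, h0] at hdim
        exact hbot ((Submodule.spanFinrank_eq_zero_iff_eq_bot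
          (maximalIdeal A).fg_of_isNoetherianRing).1 (by exact_mod_cast hdim))
    obtain ⟨s, hs, hspan⟩ :=
      Submodule.FG.exists_span_finset_card_eq_spanFinrank (maximalIdeal A).fg_of_isNoetherianRing
    obtain ⟨u, hu⟩ : ∃ u : A → A, ∑ a ∈ s, u a * a = y := by
      rw [← hspan] at hym
      obtain ⟨f, -, hf⟩ := Submodule.mem_span_finset.1 hym
      exact ⟨f, by simpa using hf⟩
    obtain ⟨a, ha, hunit⟩ : ∃ a ∈ s, u a ∉ maximalIdeal A := by
      by_contra! hcon
      refine hy2 (hu ▸ sum_mem fun a ha => ?_)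
      rw [pow_two]
      exact Ideal.mul_mem_mul (hcon a ha) (hspan ▸ Submodule.subset_span ha)
    have hpos : 0 < s.card := Finset.card_pos.2 ⟨a, ha⟩
    obtain ⟨hreg, hle⟩ := isRegularLocalRing_quotient_span {y} (s.erase a) (by
      refine le_antisymm (Ideal.span_le.2 ?_) ?_
      · rintro b hb
        rcases hb with hb | hb
        · rw [Finset.mem_coe, Finset.mem_singleton] at hb
          exact hb ▸ hym
        · exact hspan ▸ Submodule.subset_span (Finset.mem_of_mem_erase hb)
      · rw [← hspan]
        refine Ideal.span_le.2 fun b hb => ?_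
        by_cases hba : b = a
        · subst hba
          refine (Ideal.unit_mul_mem_iff_mem _ (notMem_maximalIdeal.1 hunit)).1 ?_
          have : u b * b = y - ∑ a ∈ s.erase b, u a * a := by
            rw [← hu, ← Finset.add_sum_erase _ _ ha]; ring
          rw [this]
          refine sub_mem (Ideal.subset_span (by simp)) (sum_mem fun c hc =>
            Ideal.mul_mem_left _ _ (Ideal.subset_span (Or.inr hc)))
        · exact Ideal.subset_span (Or.inr (Finset.mem_erase.2 ⟨hba, hb⟩)))
      (by rw [Finset.card_erase_of_mem ha, ← hs, Finset.card_singleton]; omega)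
    rw [Finset.card_erase_of_mem ha] at hle
    have hdom := ih (A ⧸ Ideal.span (({y} : Finset A) : Set A)) (by omega)
    rw [Finset.coe_singleton] at hdom
    have hprime : (Ideal.span {y}).IsPrime := (Ideal.Quotient.isDomain_iff_prime _).1 hdom
    obtain ⟨p, hp, hpy⟩ := Ideal.exists_minimalPrimes_le (I := (⊥ : Ideal A))
      (J := Ideal.span {y}) bot_le
    have hpp : p.IsPrime := hp.1.1
    -- `p ⊆ (y)` and `y ∉ p` give `p = y p`, so that Nakayama's lemma applies
    have hpbot : p = ⊥ := by
      refine Submodule.eq_bot_of_le_smul_of_le_jacobson_bot (Ideal.span {y}) _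
        p.fg_of_isNoetherianRing ?_ ((Ideal.span_singleton_le_iff_mem _).2 hym |>.trans
          (maximalIdeal_le_jacobson _))
      intro a ha
      obtain ⟨b, rfl⟩ := Ideal.mem_span_singleton'.1 (hpy ha)
      rw [smul_eq_mul, mul_comm b]
      exact Ideal.mul_mem_mul (Ideal.mem_span_singleton_self y)
        ((hpp.mem_or_mem ha).resolve_right (hyp p hp))
    rw [hpbot] at hpp
    exact (MulEquiv.isDomain _ (RingEquiv.quotientBot A).symm.toMulEquiv :
      IsDomain A)

/-! ### Regular systems of parameters -/

lemma maximalIdeal_pow_three_le {A ι : Type*} [CommRing A] [IsLocalRing A] {z : ι → A}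
    (hspan : Ideal.span (Set.range z) = maximalIdeal A) (i j : ι) :
    maximalIdeal A ^ 3 ≤ Ideal.span {z i} * maximalIdeal A ^ 2 ⊔
      Ideal.span {z j} * maximalIdeal A ^ 2 ⊔ Ideal.span (z '' {i, j}ᶜ) := by
  have hm : maximalIdeal A =
      Ideal.span {z i} ⊔ Ideal.span {z j} ⊔ Ideal.span (z '' {i, j}ᶜ) := by
    rw [← hspan, ← Ideal.span_union, ← Ideal.span_union]
    congr 1
    rw [← Set.image_univ, ← Set.union_compl_self {i, j}, Set.image_union, Set.image_pair,
      Set.insert_eq]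
  rw [pow_succ' _ 2]
  nth_rw 1 [hm]
  rw [Ideal.sup_mul, Ideal.sup_mul]
  exact sup_le_sup_left Ideal.mul_le_left _

section RegularParameters

variable {A ι : Type*} [CommRing A] [IsRegularLocalRing A] [Fintype ι] {z : ι → A}

lemma isPrime_span_image (hspan : Ideal.span (Set.range z) = maximalIdeal A)
    (hcard : Fintype.card ι = (maximalIdeal A).spanFinrank) (T : Set ι) :
    (Ideal.span (z '' T)).IsPrime := by
  classical
  have := Fintype.ofFinite T
  obtain ⟨h, -⟩ := isRegularLocalRing_quotient_span (T.toFinset.image z) (Tᶜ.toFinset.image z)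
    (by simpa [← Set.image_union, Set.union_compl_self] using hspan) (by
      refine (add_le_add Finset.card_image_le Finset.card_image_le).trans ?_
      rw [← hcard, Set.toFinset_compl, Finset.card_add_card_compl])
  rw [← Ideal.Quotient.isDomain_iff_prime]
  have := isDomain_of_isRegularLocalRing (A ⧸ Ideal.span ((T.toFinset.image z : Finset A) : Set A))
  rwa [Finset.coe_image, Set.coe_toFinset] at this

/-- The coefficient of a single quadratic monomial in the parameters `z i`, `z j` is determined
modulo `𝔪` by its class modulo `𝔪 ^ 3` and the other parameters. The reason is that the ideals
generated by subfamilies of `z` are prime, so that factors `z i` and `z j` can be cancelled. -/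
lemma mem_maximalIdeal_of_mul_mul_mem (hspan : Ideal.span (Set.range z) = maximalIdeal A)
    (hcard : Fintype.card ι = (maximalIdeal A).spanFinrank) {i j : ι} {c : A}
    (hc : c * (z i * z j) ∈ maximalIdeal A ^ 3 ⊔ Ideal.span (z '' {i, j}ᶜ)) :
    c ∈ maximalIdeal A := by
  have hz := irredundant_of_card_eq_spanFinrank hspan hcard
  set K := Ideal.span (z '' {i, j}ᶜ) with hK
  have hKp : K.IsPrime := isPrime_span_image hspan hcard _
  obtain ⟨a, ha, k, hk, hak⟩ := Submodule.mem_sup.1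
    (sup_le (maximalIdeal_pow_three_le hspan i j) le_sup_right hc)
  obtain ⟨a₁, ha₁, a₂, ha₂, rfl⟩ := Submodule.mem_sup.1 ha
  obtain ⟨q₁, hq₁, rfl⟩ := Ideal.mem_span_singleton_mul.1 ha₁
  obtain ⟨q₂, hq₂, rfl⟩ := Ideal.mem_span_singleton_mul.1 ha₂
  have hnot : ∀ l, l ∉ ({i, j}ᶜ : Set ι) → z l ∉ K := fun l hl h =>
    hz l (Ideal.span_mono (Set.image_mono (Set.subset_compl_singleton_iff.2 hl)) h)
  by_cases hij : i = j
  · subst hij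
    have h1 : z i * (c * z i - (q₁ + q₂)) ∈ K := by
      have : z i * (c * z i - (q₁ + q₂)) = k := by linear_combination -hak
      rwa [this]
    have h2 := (hKp.mem_or_mem h1).resolve_left (hnot i (by simp))
    refine hz.mem_maximalIdeal_of_mul_mem hspan (T := {i, i}ᶜ) (i := i) (by simp) ?_
    have : c * z i = (c * z i - (q₁ + q₂)) + (q₁ + q₂) := by ring
    rw [this]
    exact add_mem (Ideal.mem_sup_left h2) (Ideal.mem_sup_right (add_mem hq₁ hq₂))
  · have hins : ({i}ᶜ : Set ι) = insert j {i, j}ᶜ := by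
      ext x; by_cases hx : x = j <;> simp [hx, Ne.symm hij]
    have hKi : Ideal.span (z '' {i}ᶜ) = Ideal.span {z j} ⊔ K := by
      rw [hins, Set.image_insert_eq, Ideal.span_insert]
    have hq : q₁ ∈ Ideal.span {z j} ⊔ K := by
      have hp : (Ideal.span {z j} ⊔ K).IsPrime := hKi ▸ isPrime_span_image hspan hcard _
      refine (hp.mem_or_mem (x := z i) ?_).resolve_left (hKi ▸ hz i)
      have : z i * q₁ = (c * z i - q₂) * z j - k := by linear_combination hak
      rw [this]
      exact sub_mem (Ideal.mem_sup_left (Ideal.mul_mem_left _ _ (Ideal.mem_span_singleton_self _)))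
        (Ideal.mem_sup_right hk)
    obtain ⟨a, ha, k', hk', hq'⟩ := Submodule.mem_sup.1 hq
    obtain ⟨t, rfl⟩ := Ideal.mem_span_singleton'.1 ha
    have ht : t ∈ maximalIdeal A := by
      refine hz.mem_maximalIdeal_of_mul_mem hspan (T := {i, j}ᶜ) (i := j) (by simp) ?_
      rw [eq_sub_of_add_eq hq']
      exact sub_mem (Ideal.mem_sup_right hq₁) (Ideal.mem_sup_left hk')
    have h1 : z j * (z i * (c - t) - q₂) ∈ K := by
      have : z j * (z i * (c - t) - q₂) = k + z i * k' := by
        linear_combination -hak - z i * hq'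
      rw [this]
      exact add_mem hk (Ideal.mul_mem_left _ _ hk')
    have h2 := (hKp.mem_or_mem h1).resolve_left (hnot j (by simp))
    have h3 : c - t ∈ maximalIdeal A := by
      refine hz.mem_maximalIdeal_of_mul_mem hspan (T := {i, j}ᶜ) (i := i) (by simp) ?_
      have : (c - t) * z i = (z i * (c - t) - q₂) + q₂ := by ring
      rw [this]
      exact add_mem (Ideal.mem_sup_left h2) (Ideal.mem_sup_right hq₂)
    simpa using add_mem h3 ht

/-- In a regular local ring with regular system of parameters `y, w`, the quadratic monomials in `y`
are linearly independent modulo `𝔪 ^ 3 + (w)`. -/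
lemma mem_maximalIdeal_of_sum_mul_mem {κ τ : Type*} [Fintype κ] [Fintype τ]
    {y : κ → A} {w : τ → A}
    (hspan : Ideal.span (Set.range (Sum.elim y w)) = maximalIdeal A)
    (hcard : Fintype.card (κ ⊕ τ) = (maximalIdeal A).spanFinrank) (c : Sym2 κ → A)
    (hc : ∑ p, c p * (p.map y).mul ∈ maximalIdeal A ^ 3 ⊔ Ideal.span (Set.range w)) (p : Sym2 κ) :
    c p ∈ maximalIdeal A := by
  classical
  have hym : ∀ i, y i ∈ maximalIdeal A := fun i => hspan ▸ Ideal.subset_span ⟨.inl i, rfl⟩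
  -- it suffices to handle the other monomials modulo the ideal of the parameters not in `p`
  have key : ∀ i j : κ, (∀ q ≠ s(i, j), c q * (q.map y).mul ∈ maximalIdeal A ^ 3 ⊔
      Ideal.span (Sum.elim y w '' {.inl i, .inl j}ᶜ)) → c s(i, j) ∈ maximalIdeal A := by
    intro i j h
    refine mem_maximalIdeal_of_mul_mul_mem hspan hcard (i := .inl i) (j := .inl j) ?_
    rw [← Finset.add_sum_erase _ _ (Finset.mem_univ s(i, j))] at hc
    have hw : Ideal.span (Set.range w) ≤ Ideal.span (Sum.elim y w '' {.inl i, .inl j}ᶜ) :=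
      Ideal.span_mono (by rintro _ ⟨t, rfl⟩; exact ⟨.inr t, by simp, rfl⟩)
    exact (Ideal.add_mem_iff_left _ (sum_mem fun q hq => h q (Finset.ne_of_mem_erase hq))).1
      (sup_le_sup_left hw _ hc)
  have hmem : ∀ {i j a : κ} (b : κ), a ≠ i → a ≠ j → c s(a, b) * (s(a, b).map y).mul ∈
      maximalIdeal A ^ 3 ⊔ Ideal.span (Sum.elim y w '' {.inl i, .inl j}ᶜ) := by
    intro i j a b hai haj
    refine Ideal.mem_sup_right (Ideal.mul_mem_left _ _ (Ideal.mul_mem_right _ _ ?_))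
    exact Ideal.subset_span ⟨.inl a, by simp [hai, haj], rfl⟩
  have hdiag : ∀ i, c s(i, i) ∈ maximalIdeal A := by
    refine fun i => key i i fun q => ?_
    induction q with | _ a b
    intro hq
    by_cases ha : a = i
    · rw [Sym2.eq_swap]
      refine hmem a ?_ ?_ <;> rintro rfl <;> exact hq (by rw [ha])
    · exact hmem b ha ha
  induction p with | _ i j
  refine key i j fun q => ?_
  induction q with | _ a b
  intro hq
  by_cases ha : a ≠ i ∧ a ≠ j
  · exact hmem b ha.1 ha.2
  by_cases hb : b ≠ i ∧ b ≠ j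
  · rw [Sym2.eq_swap]
    exact hmem a hb.1 hb.2
  obtain rfl : a = b := by
    by_contra hab
    apply hq
    rw [Sym2.eq_iff]
    grind
  refine Ideal.mem_sup_left ?_
  rw [pow_succ']
  refine Ideal.mul_mem_mul (hdiag a) ?_
  rw [pow_two]
  exact Ideal.mul_mem_mul (hym a) (hym a)

end RegularParameters

/-! ### The bound on the embedding dimension -/

lemma height_add_ringKrullDim_quotient_le {A : Type*} [CommRing A] (I : Ideal A) :
    (I.height : WithBot ℕ∞) + ringKrullDim (A ⧸ I) ≤ ringKrullDim A := by
  rw [ringKrullDim_quotient]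
  rcases isEmpty_or_nonempty (PrimeSpectrum.zeroLocus (I : Set A)) with h | h
  · simp [Order.krullDim_eq_bot]
  have : Nonempty (PrimeSpectrum A) := h.map Subtype.val
  rw [ringKrullDim, Order.krullDim_eq_iSup_coheight_of_nonempty,
    Order.krullDim_eq_iSup_height_add_coheight_of_nonempty]
  norm_cast
  rw [ENat.add_iSup]
  refine iSup_le fun p => le_iSup_of_le p.1 (add_le_add ?_ ?_)
  · have hp : I ≤ p.1.asIdeal := p.2
    exact (Ideal.height_mono hp).trans (PrimeSpectrum.height_eq_orderHeight _).le
  · exact Order.coheight_le_coheight_apply_of_strictMono Subtype.val (fun _ _ h => h) p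

/-- A family that is part of a minimal generating set of an ideal of a Noetherian ring can be
completed by finitely many elements to an irredundant generating family. -/
lemma IsPartOfMinimalGeneratingSet.exists_irredundant {R : Type*} [CommRing R]
    [IsNoetherianRing R] {I : Ideal R} {d : ℕ} {x : Fin d → R}
    (hx : IsPartOfMinimalGeneratingSet x I) :
    ∃ (k : ℕ) (y : Fin k → R), Ideal.span (Set.range (Sum.elim x y)) = I ∧
      Irredundant (Sum.elim x y) := by
  classical
  obtain ⟨hinj, S, hxS, hS⟩ := hx
  have hfin : S.Finite := by
    obtain ⟨s', hs', h⟩ := (Submodule.fg_span_iff_fg_span_finset_subset (R := R) S).1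
      (IsNoetherian.noetherian _)
    exact s'.finite_toSet.subset (hS.2 (h.symm.trans hS.1) hs')
  have hSx : (S \ Set.range x).Finite := hfin.sdiff
  have := hSx.fintype
  let e := (Fintype.equivFin (S \ Set.range x : Set R)).symm
  have hr : Set.range (Sum.elim x (fun i => (e i : R))) = S := by
    rw [Set.Sum.elim_range, show (fun i => (e i : R)) = Subtype.val ∘ e from rfl,
      e.surjective.range_comp, Subtype.range_coe, Set.union_sdiff_cancel hxS]
  have hi : Function.Injective (Sum.elim x (fun i => (e i : R))) := by
    refine hinj.sumElim (Subtype.val_injective.comp e.injective) fun a b h => ?_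
    exact (e b).2.2 ⟨a, h⟩
  refine ⟨_, fun i => (e i : R), by rw [hr]; exact hS.1, fun i h => ?_⟩
  have himg : Sum.elim x (fun i => (e i : R)) '' {i}ᶜ = S \ {Sum.elim x (fun i => (e i : R)) i} := by
    rw [Set.image_compl_eq_range_sdiff_image hi, hr, Set.image_singleton]
  have hmem : Sum.elim x (fun i => (e i : R)) i ∈ S := hr.subset ⟨i, rfl⟩
  rw [himg] at h
  have hspan : Ideal.span (S \ {Sum.elim x (fun i => (e i : R)) i}) = I := by
    have h1 := Submodule.span_insert_eq_span h
    rw [Set.insert_sdiff_singleton, Set.insert_eq_of_mem hmem] at h1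
    exact h1.symm.trans hS.1
  exact (hS.2 hspan Set.sdiff_subset hmem).2 rfl

lemma card_le_card_of_matrix_mul_eq_one {K m n : Type*} [Field K] [Fintype m] [Fintype n]
    [DecidableEq m] (N : Matrix m n K) (M : Matrix n m K) (h : N * M = 1) :
    Fintype.card m ≤ Fintype.card n := by
  rw [← Matrix.rank_one (R := K) (n := m), ← h]
  exact (Matrix.rank_mul_le_left N M).trans (Matrix.rank_le_card_width N)

/-- The inequality `embdim R - dim R ≤ 2`, with `k = embdim R - d`. Lift the generators `x, y` of
`𝔪_R` to the regular ring `A` and complete them by `s` of the generators of the kernel to a regular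
system of parameters. Modulo the lifts of `x` and these `s` elements, the kernel becomes the square
of the maximal ideal, which needs `k (k + 1) / 2` generators, while at most `k + 1` generators of
the kernel remain. -/
theorem card_le_two_of_irredundant {A R : Type*} [CommRing A] [IsRegularLocalRing A] [CommRing R]
    [IsLocalRing R] [IsNoetherianRing R] (φ : A →+* R) (hφ : Function.Surjective φ)
    (hker : ((RingHom.ker φ).spanFinrank : ℕ∞) = (RingHom.ker φ).height + 1)
    {d k : ℕ} {x : Fin d → R} {y : Fin k → R} (hdim : ringKrullDim R = d)
    (hm : maximalIdeal R ^ 2 ≤ Ideal.span (Set.range x))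
    (hspan : Ideal.span (Set.range (Sum.elim x y)) = maximalIdeal R)
    (hirr : Irredundant (Sum.elim x y)) : k ≤ 2 := by
  classical
  choose X hX using fun i => hφ (x i)
  choose Y hY using fun i => hφ (y i)
  obtain ⟨G, hGcard, hG⟩ := Submodule.FG.exists_span_finset_card_eq_spanFinrank
    (RingHom.ker φ).fg_of_isNoetherianRing
  replace hG : Ideal.span (G : Set A) = RingHom.ker φ := hG
  have hloc : IsLocalHom φ := .of_surjective φ hφ
  have hφm : (maximalIdeal A).map φ = maximalIdeal R :=
    map_maximalIdeal_of_surjective φ hφ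
  have hmφ : (maximalIdeal R).comap φ = maximalIdeal A :=
    maximalIdeal_comap φ
  -- a minimal set `B` of generators of the kernel that completes the lifts to generators of `𝔪`
  obtain ⟨B, hBG, hB⟩ := exists_minimal_le_of_wellFoundedLT
    (fun B : Finset A => Ideal.span (Set.range X ∪ Set.range Y ∪ B) = maximalIdeal A) G (by
      rw [Ideal.span_union, hG, Ideal.span_union]
      have h1 : Ideal.map φ (Ideal.span (Set.range X) ⊔ Ideal.span (Set.range Y)) =
          maximalIdeal R := by
        rw [Ideal.map_sup, Ideal.map_span, Ideal.map_span, ← Set.range_comp, ← Set.range_comp,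
          ← Ideal.span_union, ← hspan, Set.Sum.elim_range]
        congr 3 <;> (ext i; simp [hX, hY])
      rw [← hmφ, ← h1, Ideal.comap_map_of_surjective' φ hφ])
  let w : Fin d ⊕ B → A := Sum.elim X (fun b => (b : A))
  have hzr : Set.range (Sum.elim Y w) = Set.range X ∪ Set.range Y ∪ B := by
    simp only [w, Set.Sum.elim_range, Subtype.range_coe_subtype, Finset.setOfPred_mem]
    rw [← Set.union_assoc, Set.union_comm (Set.range Y)]
  have hzspan : Ideal.span (Set.range (Sum.elim Y w)) = maximalIdeal A := hzr ▸ hB.1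
  have hBker : ∀ b ∈ B, φ b = 0 := fun b hb => by
    rw [← RingHom.mem_ker, ← hG]
    exact Ideal.subset_span (hBG hb)
  have hzirr : Irredundant (Sum.elim Y w) := by
    have hlift : ∀ (l : Fin k ⊕ Fin d ⊕ B) (j : Fin d ⊕ Fin k),
        φ (Sum.elim Y w l) = Sum.elim x y j →
        (∀ l' ≠ l, φ (Sum.elim Y w l') ∈ Ideal.span (Sum.elim x y '' {j}ᶜ)) →
        Sum.elim Y w l ∉ Ideal.span (Sum.elim Y w '' {l}ᶜ) := by
      intro l j hlj hl' hmem
      refine hirr j ?_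
      rw [← hlj]
      refine Ideal.mem_comap.1 (Ideal.span_le.2 ?_ hmem)
      rintro _ ⟨l', hl, rfl⟩
      exact hl' l' hl
    rintro (i | i | b)
    · refine hlift _ (.inr i) (by simp [hY]) ?_
      rintro (i' | i' | b') h
      · exact Ideal.subset_span ⟨.inr i', by simpa using h, by simp [hY]⟩
      · exact Ideal.subset_span ⟨.inl i', by simp, by simp [w, hX]⟩
      · simp [w, hBker b' b'.2]
    · refine hlift _ (.inl i) (by simp [w, hX]) ?_
      rintro (i' | i' | b') h
      · exact Ideal.subset_span ⟨.inr i', by simp, by simp [hY]⟩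
      · exact Ideal.subset_span ⟨.inl i', by simpa using h, by simp [w, hX]⟩
      · simp [w, hBker b' b'.2]
    · intro hb
      have hle : Ideal.span (Set.range X ∪ Set.range Y ∪ (B.erase b : Finset A)) =
          maximalIdeal A := by
        refine le_antisymm ?_ ?_
        · rw [← hB.1]
          exact Ideal.span_mono (Set.union_subset_union_right _ (by simp))
        · rw [← hzspan, Ideal.span_le]
          rintro _ ⟨i | i | b', rfl⟩
          · exact Ideal.subset_span (.inl (.inr ⟨i, rfl⟩))
          · exact Ideal.subset_span (.inl (.inl ⟨i, rfl⟩))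
          · by_cases hbb : b' = b
            · subst hbb
              refine Ideal.span_mono ?_ hb
              rintro _ ⟨i | i | b'', hne, rfl⟩
              · exact .inl (.inr ⟨i, rfl⟩)
              · exact .inl (.inl ⟨i, rfl⟩)
              · refine .inr (Finset.mem_erase.2 ⟨fun h => hne ?_, b''.2⟩)
                rw [Set.mem_singleton_iff, Subtype.ext h]
            · exact Ideal.subset_span
                (.inr (Finset.mem_erase.2 ⟨fun h => hbb (Subtype.ext h), b'.2⟩))
      exact Finset.notMem_erase _ _ (hB.2 hle (Finset.erase_subset _ _) b.2)
  have hcard := hzirr.card_eq_spanFinrank hzspan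
  have hcardle : (G \ B).card ≤ k + 1 := by
    have h1 := height_add_ringKrullDim_quotient_le (RingHom.ker φ)
    rw [ringKrullDim_eq_of_ringEquiv (RingHom.quotientKerEquivOfSurjective hφ), hdim,
      ← IsRegularLocalRing.spanFinrank_maximalIdeal, ← hcard] at h1
    simp only [Fintype.card_sum, Fintype.card_fin, Fintype.card_coe] at h1
    rw [← hGcard] at hker
    rw [Finset.card_sdiff_of_subset hBG]
    generalize (RingHom.ker φ).height = h at *
    induction h with
    | top => simp at hker
    | coe h =>
      norm_cast at h1 hker
      omega
  set J := Ideal.span (Set.range w) with hJ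
  have hmJ : maximalIdeal A = Ideal.span (Set.range Y) ⊔ J := by
    rw [← hzspan, Set.Sum.elim_range, Ideal.span_union]
  let mon : Sym2 (Fin k) → A := fun p => (p.map Y).mul
  have hmon : maximalIdeal A * Ideal.span (Set.range Y) ≤ Ideal.span (Set.range mon) ⊔ J := by
    rw [hmJ, Ideal.sup_mul]
    refine sup_le (le_sup_of_le_left ?_) (le_sup_of_le_right Ideal.mul_le_left)
    rw [Ideal.span_mul_span', Ideal.span_le]
    rintro _ ⟨_, ⟨i, rfl⟩, _, ⟨j, rfl⟩, rfl⟩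
    exact Ideal.subset_span ⟨s(i, j), rfl⟩
  -- elements of the kernel have no linear part along `Y`
  have hkermon : RingHom.ker φ ≤ Ideal.span (Set.range mon) ⊔ J := by
    intro a ha
    have ham : a ∈ maximalIdeal A := le_maximalIdeal (RingHom.ker_ne_top φ) ha
    rw [← hzspan] at ham
    obtain ⟨c, hc⟩ := Ideal.mem_span_range_iff_exists_fun.1 ham
    simp only [Fintype.sum_sum_type, Sum.elim_inl, Sum.elim_inr] at hc
    have h0 : ∑ i, Sum.elim (fun i => φ (c (.inr (.inl i)))) (fun i => φ (c (.inl i))) i *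
        Sum.elim x y i = 0 := by
      rw [RingHom.mem_ker, ← hc] at ha
      simp only [map_add, map_sum, map_mul, w, Sum.elim_inl, Sum.elim_inr, hX, hY,
        fun b : B => hBker b b.2, mul_zero, Finset.sum_const_zero, add_zero] at ha
      simp only [Fintype.sum_sum_type, Sum.elim_inl, Sum.elim_inr]
      rw [add_comm]
      exact ha
    have hcm : ∀ i, c (.inl i) ∈ maximalIdeal A := fun i => by
      have := hirr.mem_maximalIdeal_of_sum_mem hspan (h0 ▸ zero_mem _) (.inr i)
      rw [← hmφ]
      exact this
    rw [← hc]
    refine add_mem (sum_mem fun i _ => hmon (Ideal.mul_mem_mul (hcm i)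
      (Ideal.subset_span ⟨i, rfl⟩))) (Ideal.mem_sup_right (add_mem ?_ ?_))
    · exact sum_mem fun i _ => Ideal.mul_mem_left _ _ (Ideal.subset_span ⟨.inl i, rfl⟩)
    · exact sum_mem fun i _ => Ideal.mul_mem_left _ _ (Ideal.subset_span ⟨.inr i, rfl⟩)
  have hmonker : ∀ p, mon p ∈ Ideal.span ((G \ B : Finset A) : Set A) ⊔ J := by
    intro p
    have h1 : mon p ∈ (Ideal.map φ (Ideal.span (Set.range X))).comap φ := by
      rw [Ideal.mem_comap, Ideal.map_span, ← Set.range_comp, show φ ∘ X = x from funext hX]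
      refine hm ?_
      induction p with | _ i j
      have hy : ∀ i, φ (Y i) ∈ maximalIdeal R := fun i => by
        rw [hY, ← hspan]; exact Ideal.subset_span ⟨.inr i, rfl⟩
      rw [pow_two, show mon s(i, j) = Y i * Y j from rfl, map_mul]
      exact Ideal.mul_mem_mul (hy i) (hy j)
    rw [Ideal.comap_map_of_surjective' φ hφ, ← hG] at h1
    have hle : Ideal.span (Set.range X) ⊔ Ideal.span (G : Set A) ≤
        Ideal.span ((G \ B : Finset A) : Set A) ⊔ J := by
      refine sup_le (le_sup_of_le_right (Ideal.span_mono ?_)) (Ideal.span_le.2 fun g hg => ?_)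
      · rintro _ ⟨i, rfl⟩
        exact ⟨.inl i, rfl⟩
      · by_cases hgB : g ∈ B
        · exact Ideal.mem_sup_right (Ideal.subset_span ⟨.inr ⟨g, hgB⟩, rfl⟩)
        · exact Ideal.mem_sup_left (Ideal.subset_span (Finset.mem_sdiff.2 ⟨hg, hgB⟩))
    exact hle h1
  -- the quadratic monomials and the remaining generators span the same ideal modulo `J`, and the
  -- two transition matrices compose to the identity over the residue field
  have hN : ∀ p, ∃ c : (G \ B : Finset A) → A, mon p - ∑ g, c g * (g : A) ∈ J := by
    intro p
    obtain ⟨a, ha, b, hb, hab⟩ := Submodule.mem_sup.1 (hmonker p)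
    obtain ⟨c, rfl⟩ := Submodule.mem_span_finset'.1 ha
    exact ⟨c, by simpa [← hab] using hb⟩
  have hM : ∀ g : (G \ B : Finset A), ∃ c : Sym2 (Fin k) → A, (g : A) - ∑ q, c q * mon q ∈ J := by
    intro g
    have hg : (g : A) ∈ RingHom.ker φ := by
      rw [← hG]; exact Ideal.subset_span (Finset.mem_sdiff.1 g.2).1
    obtain ⟨a, ha, b, hb, hab⟩ := Submodule.mem_sup.1 (hkermon hg)
    obtain ⟨c, rfl⟩ := Ideal.mem_span_range_iff_exists_fun.1 ha
    exact ⟨c, by simpa [← hab] using hb⟩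
  choose N hN using hN
  choose M hM using hM
  have hNM : (Matrix.of fun p g => residue A (N p g)) * (Matrix.of fun g q => residue A (M g q)) =
      1 := by
    ext p q
    have h := mem_maximalIdeal_of_sum_mul_mem hzspan hcard
      (fun q => (if q = p then 1 else 0) - ∑ g, N p g * M g q) (Ideal.mem_sup_right ?_) q
    · rw [← residue_eq_zero_iff, map_sub, sub_eq_zero] at h
      simp only [Matrix.mul_apply, Matrix.of_apply, Matrix.one_apply]
      rw [map_sum] at h
      simp only [map_mul] at h
      rw [← h]
      simp only [eq_comm (a := p)]
      split_ifs <;> simp only [map_one, map_zero]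
    · have : ∑ q, ((if q = p then 1 else 0) - ∑ g, N p g * M g q) * (q.map Y).mul =
          (mon p - ∑ g, N p g * (g : A)) + ∑ g, N p g * ((g : A) - ∑ q, M g q * mon q) := by
        simp only [sub_mul, mul_sub, Finset.sum_sub_distrib, Finset.sum_mul, Finset.mul_sum,
          ite_mul, one_mul, zero_mul, Finset.sum_ite_eq', Finset.mem_univ, if_true]
        rw [Finset.sum_comm]
        simp only [mon, mul_assoc]
        ring
      rw [this]
      exact add_mem (hN p) (sum_mem fun g _ => Ideal.mul_mem_left _ _ (hM g))
  have h := card_le_card_of_matrix_mul_eq_one _ _ hNM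
  rw [Sym2.card, Fintype.card_fin, Fintype.card_coe] at h
  by_contra hk
  have h2 : (k + 1).choose 2 * 2 = (k + 1) * k := by
    rw [Nat.choose_two_right, Nat.div_mul_cancel]
    · simp
    · simpa using (Nat.even_mul_pred_self (k + 1)).two_dvd
  nlinarith

/-! ### Averages of antitone functions on exponent vectors -/

/-- The exponent vectors of the monomials of degree less than `n` in `d` variables. -/
noncomputable def degreeLT (d n : ℕ) : Finset (Fin d →₀ ℕ) :=
  (Finsupp.finite_of_degree_lt n).toFinset

@[simp]
lemma mem_degreeLT {d n : ℕ} {a : Fin d →₀ ℕ} : a ∈ degreeLT d n ↔ a.degree < n := by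
  simp [degreeLT]

lemma factorial_mul_card_degreeLT_succ (d n : ℕ) :
    d.factorial * (degreeLT d (n + 1)).card = (n + 1).ascFactorial d := by
  have h : degreeLT d (n + 1) =
      (Finset.range (n + 1)).biUnion (Finset.finsuppAntidiag (Finset.univ : Finset (Fin d))) := by
    ext a
    simp [Finsupp.degree_eq_sum]
  rw [h, Finset.card_biUnion, Nat.ascFactorial_eq_factorial_mul_choose,
    ← Nat.sum_range_multichoose]
  · simp only [Finset.card_finsuppAntidiag_nat_eq_multichoose, Finset.card_univ, Fintype.card_fin]
  · intro i _ j _ hij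
    refine Finset.disjoint_left.2 fun a ha hb => hij ?_
    rw [Finset.mem_finsuppAntidiag] at ha hb
    exact ha.1.symm.trans hb.1

lemma tendsto_natCast_add_const_div (c : ℝ) (d : ℕ) :
    Filter.Tendsto (fun n : ℕ => ((n : ℝ) + c) ^ d / (n : ℝ) ^ d) Filter.atTop (nhds 1) := by
  have h : Filter.Tendsto (fun n : ℕ => (1 + c / (n : ℝ)) ^ d) Filter.atTop (nhds ((1 + 0) ^ d)) :=
    (tendsto_const_nhds.add (tendsto_const_div_atTop_nhds_zero_nat c)).pow d
  rw [add_zero, one_pow] at h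
  refine h.congr' ?_
  filter_upwards [Filter.eventually_gt_atTop 0] with n hn
  have : (n : ℝ) ≠ 0 := by positivity
  rw [← div_pow, add_div, div_self this]

lemma tendsto_card_degreeLT (d s : ℕ) :
    Filter.Tendsto (fun n : ℕ => (d.factorial : ℝ) * (degreeLT d (n - s)).card / (n : ℝ) ^ d)
      Filter.atTop (nhds 1) := by
  refine tendsto_of_tendsto_of_tendsto_of_le_of_le' (tendsto_natCast_add_const_div (-s) d)
    (tendsto_natCast_add_const_div d d) ?_ ?_
  all_goals
    filter_upwards [Filter.eventually_gt_atTop s] with n hn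
    obtain ⟨m, rfl⟩ : ∃ m, n = m + 1 + s := ⟨n - s - 1, by omega⟩
    rw [Nat.add_sub_cancel]
    have h : (d.factorial : ℝ) * (degreeLT d (m + 1)).card = ((m + 1).ascFactorial d : ℕ) := by
      rw [← factorial_mul_card_degreeLT_succ]; push_cast; ring
    rw [h]
    gcongr
  · have := Nat.pow_succ_le_ascFactorial (m + 1) d
    have h2 : (((m + 1) ^ d : ℕ) : ℝ) ≤ ((m + 1).ascFactorial d : ℕ) := by exact_mod_cast this
    refine le_trans (le_of_eq ?_) h2
    push_cast
    ring
  · have := (Nat.ascFactorial_le_pow_add m d).trans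
      (Nat.pow_le_pow_left (show m + d ≤ m + 1 + s + d by omega) d)
    exact_mod_cast this

/-- An antitone function takes its minimal value on all exponents beyond one point, that is, on all
but a vanishing proportion of the exponents of degree less than `n`. -/
lemma tendsto_sum_degreeLT {d : ℕ} {f : (Fin d →₀ ℕ) → ℕ} (hf : Antitone f) {a₀ : Fin d →₀ ℕ}
    (ha₀ : ∀ a, f a₀ ≤ f a) :
    Filter.Tendsto
      (fun n : ℕ => (d.factorial : ℝ) * ((∑ a ∈ degreeLT d n, f a : ℕ) : ℝ) / (n : ℝ) ^ d)
      Filter.atTop (nhds (f a₀)) := by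
  classical
  set s := a₀.degree
  have h0 := tendsto_card_degreeLT d 0
  have hs := tendsto_card_degreeLT d s
  have hlow := h0.const_mul (f a₀ : ℝ)
  have hup := (hs.const_mul (f a₀ : ℝ)).add ((h0.sub hs).const_mul (f 0 : ℝ))
  rw [mul_one] at hlow
  rw [mul_one, sub_self, mul_zero, add_zero] at hup
  refine tendsto_of_tendsto_of_tendsto_of_le_of_le hlow hup (fun n => ?_) (fun n => ?_)
  · have h1 : (degreeLT d n).card * f a₀ ≤ ∑ a ∈ degreeLT d n, f a := by
      simpa using Finset.card_nsmul_le_sum _ _ _ fun a _ => ha₀ a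
    have h2 : ((degreeLT d n).card : ℝ) * f a₀ ≤ ((∑ a ∈ degreeLT d n, f a : ℕ) : ℝ) := by
      exact_mod_cast h1
    dsimp only
    rw [Nat.sub_zero, ← mul_div_assoc]
    gcongr ?_ / _
    calc (f a₀ : ℝ) * (d.factorial * (degreeLT d n).card)
        = d.factorial * ((degreeLT d n).card * f a₀) := by ring
      _ ≤ _ := by gcongr
  · set T := (degreeLT d (n - s)).map (addLeftEmbedding a₀) with hT
    have hTsub : T ⊆ degreeLT d n := by
      intro a ha
      obtain ⟨b, hb, rfl⟩ := Finset.mem_map.1 ha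
      rw [mem_degreeLT] at hb ⊢
      simp only [addLeftEmbedding_apply, map_add]
      omega
    have hTcard : T.card = (degreeLT d (n - s)).card := Finset.card_map _
    have hsd : (degreeLT d n \ T).card = (degreeLT d n).card - T.card :=
      Finset.card_sdiff_of_subset hTsub
    have hle := Finset.card_le_card hTsub
    have h1 : ∑ a ∈ degreeLT d n, f a ≤
        T.card * f a₀ + ((degreeLT d n).card - T.card) * f 0 := by
      rw [← Finset.sum_sdiff hTsub, add_comm, ← hsd]
      refine add_le_add ?_ ?_
      · refine (Finset.sum_le_card_nsmul _ _ (f a₀) fun a ha => ?_).trans (by simp)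
        obtain ⟨b, -, rfl⟩ := Finset.mem_map.1 ha
        exact hf (by simp)
      · exact (Finset.sum_le_card_nsmul _ _ (f 0) fun a _ => hf zero_le).trans (by simp)
    have h2 : ((∑ a ∈ degreeLT d n, f a : ℕ) : ℝ) ≤ (degreeLT d (n - s)).card * f a₀ +
        ((degreeLT d n).card - (degreeLT d (n - s)).card) * f 0 := by
      rw [← hTcard, ← Nat.cast_sub hle]
      exact_mod_cast h1
    dsimp only
    rw [Nat.sub_zero, ← sub_div, ← mul_div_assoc, ← mul_div_assoc, ← add_div]
    gcongr ?_ / _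
    calc (d.factorial : ℝ) * ((∑ a ∈ degreeLT d n, f a : ℕ) : ℝ)
        ≤ d.factorial * ((degreeLT d (n - s)).card * f a₀ +
          ((degreeLT d n).card - (degreeLT d (n - s)).card) * f 0) := by gcongr
      _ = _ := by ring

/-! ### Filtration of the powers of an ideal by monomials -/

section Monomials

variable {R : Type*} [CommRing R] {d : ℕ} (x : Fin d → R)

/-- The monomial with exponent vector `a` in the elements `x`. -/
def xpow (a : Fin d →₀ ℕ) : R := ∏ i, x i ^ a i

lemma xpow_add (a b : Fin d →₀ ℕ) : xpow x (a + b) = xpow x a * xpow x b := by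
  simp [xpow, pow_add, Finset.prod_mul_distrib]

@[simp]
lemma xpow_zero : xpow x 0 = 1 := by simp [xpow]

@[simp]
lemma xpow_single (i : Fin d) : xpow x (Finsupp.single i 1) = x i := by
  rw [xpow, Finset.prod_eq_single i] <;> simp +contextual [eq_comm]

lemma xpow_mem_pow (a : Fin d →₀ ℕ) : xpow x a ∈ Ideal.span (Set.range x) ^ a.degree := by
  rw [Finsupp.degree_eq_sum, ← Finset.prod_pow_eq_pow_sum]
  exact Ideal.prod_mem_prod fun i _ =>
    Ideal.pow_mem_pow (Ideal.subset_span (Set.mem_range_self i)) _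

/-- The ideal generated by the monomials with exponents in `E`. -/
def monomialSpan (E : Set (Fin d →₀ ℕ)) : Ideal R := Ideal.span (xpow x '' E)

lemma xpow_mem_monomialSpan {E : Set (Fin d →₀ ℕ)} {a : Fin d →₀ ℕ} (ha : a ∈ E) :
    xpow x a ∈ monomialSpan x E := Ideal.subset_span ⟨a, ha, rfl⟩

lemma monomialSpan_mono {E F : Set (Fin d →₀ ℕ)} (h : E ⊆ F) :
    monomialSpan x E ≤ monomialSpan x F := Ideal.span_mono (Set.image_mono h)

lemma monomialSpan_union (E F : Set (Fin d →₀ ℕ)) :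
    monomialSpan x (E ∪ F) = monomialSpan x E ⊔ monomialSpan x F := by
  rw [monomialSpan, Set.image_union, Ideal.span_union]; rfl

lemma xpow_mul_mem_monomialSpan {E F : Set (Fin d →₀ ℕ)} (a : Fin d →₀ ℕ)
    (h : ∀ b ∈ E, a + b ∈ F) {r : R} (hr : r ∈ monomialSpan x E) :
    xpow x a * r ∈ monomialSpan x F := by
  have : monomialSpan x E ≤ Submodule.comap (LinearMap.mulLeft R (xpow x a)) (monomialSpan x F) := by
    refine Ideal.span_le.2 ?_
    rintro _ ⟨b, hb, rfl⟩
    change xpow x a * xpow x b ∈ monomialSpan x F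
    rw [← xpow_add]
    exact xpow_mem_monomialSpan x (h b hb)
  exact this hr

lemma pow_eq_monomialSpan (n : ℕ) :
    Ideal.span (Set.range x) ^ n = monomialSpan x {a | n ≤ a.degree} := by
  refine le_antisymm ?_ (Ideal.span_le.2 ?_)
  · induction n with
    | zero =>
      rw [pow_zero, Ideal.one_eq_top, top_le_iff, Ideal.eq_top_iff_one, ← xpow_zero x]
      exact xpow_mem_monomialSpan x (by simp)
    | succ n ih =>
      rw [pow_succ']
      refine (Ideal.mul_mono_right ih).trans (Ideal.mul_le.2 fun r hr s hs => ?_)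
      obtain ⟨c, rfl⟩ := Ideal.mem_span_range_iff_exists_fun.1 hr
      rw [Finset.sum_mul]
      refine sum_mem fun i _ => ?_
      rw [mul_assoc]
      refine Ideal.mul_mem_left _ _ ?_
      rw [← xpow_single x i]
      refine xpow_mul_mem_monomialSpan x _ (fun b hb => ?_) hs
      simp only [Set.mem_ofPred_eq, map_add, Finsupp.degree_single] at hb ⊢
      omega
  · rintro _ ⟨a, ha, rfl⟩
    exact Ideal.pow_le_pow_right ha (xpow_mem_pow x a)

/-- The ideal of the coefficients `r` such that `r x ^ a` is a combination of the monomials that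
are larger than `x ^ a` in the degree-lexicographic order. -/
def leadingIdeal (a : Fin d →₀ ℕ) : Ideal R :=
  Submodule.comap (LinearMap.toSpanSingleton R R (xpow x a))
    (monomialSpan x {b | toDegLex a < toDegLex b})

variable {x} in
lemma mem_leadingIdeal {a : Fin d →₀ ℕ} {r : R} : r ∈ leadingIdeal x a ↔
    r * xpow x a ∈ monomialSpan x {b | toDegLex a < toDegLex b} := Iff.rfl

lemma toDegLex_add_lt_add_left {a b : Fin d →₀ ℕ} (h : toDegLex a < toDegLex b)
    (c : Fin d →₀ ℕ) : toDegLex (a + c) < toDegLex (c + b) := by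
  rw [add_comm, toDegLex_add, toDegLex_add]
  exact add_lt_add_right h (toDegLex c)

lemma leadingIdeal_mono : Monotone (leadingIdeal x) := by
  intro a b hab r hr
  obtain ⟨c, rfl⟩ := exists_add_of_le hab
  have h : r * xpow x (a + c) = xpow x c * (r * xpow x a) := by rw [xpow_add]; ring
  have h2 := xpow_mul_mem_monomialSpan x c (F := {e | toDegLex (a + c) < toDegLex e})
    (fun e he => toDegLex_add_lt_add_left he c) (mem_leadingIdeal.1 hr)
  rw [← h] at h2
  exact mem_leadingIdeal.2 h2

lemma span_le_leadingIdeal (a : Fin d →₀ ℕ) : Ideal.span (Set.range x) ≤ leadingIdeal x a := by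
  refine Ideal.span_le.2 ?_
  rintro _ ⟨i, rfl⟩
  change x i * xpow x a ∈ monomialSpan x {b | toDegLex a < toDegLex b}
  rw [← xpow_single x i, ← xpow_add]
  refine xpow_mem_monomialSpan x (Finsupp.DegLex.lt_iff.2 (.inl ?_))
  simp

end Monomials

/-- Additivity of length along `0 → R ⧸ (I : r) → R ⧸ I → R ⧸ (I + (r)) → 0`. -/
lemma length_quotient_eq_add {R : Type*} [CommRing R] (I : Ideal R) (r : R) :
    Module.length R (R ⧸ I) =
      Module.length R (R ⧸ (Submodule.comap (LinearMap.toSpanSingleton R R r) I : Ideal R)) +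
        Module.length R (R ⧸ I ⊔ Ideal.span {r}) := by
  let f : (R ⧸ (Submodule.comap (LinearMap.toSpanSingleton R R r) I : Ideal R)) →ₗ[R] (R ⧸ I) :=
    Submodule.mapQ _ I (LinearMap.toSpanSingleton R R r) le_rfl
  let g : (R ⧸ I) →ₗ[R] (R ⧸ I ⊔ Ideal.span {r}) := Submodule.factor le_sup_left
  refine Module.length_eq_add_of_exact f g ?_ (Submodule.factor_surjective _) ?_
  · rw [← LinearMap.ker_eq_bot]
    simp [f, Submodule.ker_mapQ]
  · rw [LinearMap.exact_iff]
    ext a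
    obtain ⟨a, rfl⟩ := Submodule.mkQ_surjective _ a
    constructor
    · intro h
      have ha : a ∈ I ⊔ Ideal.span {r} := by
        exact (Submodule.Quotient.mk_eq_zero _).1 h
      obtain ⟨b, hb, c, hc, rfl⟩ := Submodule.mem_sup.1 ha
      obtain ⟨t, rfl⟩ := Ideal.mem_span_singleton'.1 hc
      refine ⟨Submodule.mkQ _ t, ?_⟩
      rw [map_add, show I.mkQ b = 0 from (Submodule.Quotient.mk_eq_zero I).2 hb, zero_add]
      rfl
    · rintro ⟨b, hb⟩
      obtain ⟨b, rfl⟩ := Submodule.mkQ_surjective _ b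
      rw [← hb]
      change (Submodule.Quotient.mk (b • r) : R ⧸ I ⊔ Ideal.span {r}) = 0
      exact (Submodule.Quotient.mk_eq_zero _).2
        (Ideal.mem_sup_right (Ideal.mul_mem_left _ _ (Ideal.mem_span_singleton_self r)))

section Length

variable {R : Type*} [CommRing R] {d : ℕ} (x : Fin d → R)

/-- Removing the exponents of an initial segment `D` one at a time, the largest first, each step
contributes the length of a quotient by a leading ideal. -/
lemma length_quotient_monomialSpan_compl (D : Finset (Fin d →₀ ℕ))
    (hD : ∀ a ∈ D, ∀ b, toDegLex b < toDegLex a → b ∈ D) :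
    Module.length R (R ⧸ monomialSpan x (D : Set (Fin d →₀ ℕ))ᶜ) =
      ∑ a ∈ D, Module.length R (R ⧸ leadingIdeal x a) := by
  classical
  induction D using Finset.induction_on_max_value (f := (toDegLex : (Fin d →₀ ℕ) → _)) with
  | empty =>
    have : monomialSpan x ((∅ : Finset (Fin d →₀ ℕ)) : Set (Fin d →₀ ℕ))ᶜ = ⊤ := by
      rw [Ideal.eq_top_iff_one, ← xpow_zero x]
      exact xpow_mem_monomialSpan x (by simp)
    rw [this]
    simp
  | insert a s ha hs ih =>
    have hlt : ∀ b ∈ s, toDegLex b < toDegLex a := fun b hb =>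
      lt_of_le_of_ne (hs b hb) fun h => ha (toDegLex_injective h ▸ hb)
    have h1 : ((insert a s : Finset (Fin d →₀ ℕ)) : Set (Fin d →₀ ℕ))ᶜ =
        {b | toDegLex a < toDegLex b} := by
      ext b
      simp only [Finset.coe_insert, Set.mem_compl_iff, Set.mem_insert_iff, Finset.mem_coe, not_or,
        Set.mem_ofPred_eq]
      constructor
      · rintro ⟨hba, hbs⟩
        by_contra hcon
        have := hD a (Finset.mem_insert_self _ _) b
          (lt_of_le_of_ne (not_lt.1 hcon) fun h => hba (toDegLex_injective h))
        exact (Finset.mem_insert.1 this).elim hba hbs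
      · exact fun h => ⟨by rintro rfl; exact lt_irrefl _ h, fun hb => lt_asymm h (hlt b hb)⟩
    have h2 : (s : Set (Fin d →₀ ℕ))ᶜ = {b | toDegLex a < toDegLex b} ∪ {a} := by
      rw [← h1]
      ext b
      by_cases hb : b = a <;> simp [hb, ha]
    rw [Finset.sum_insert ha, ← ih fun b hb c hc => ?_, h1, h2, monomialSpan_union,
      length_quotient_eq_add _ (xpow x a),
      show monomialSpan x {a} = Ideal.span {xpow x a} by simp [monomialSpan]]
    · rfl
    · refine (Finset.mem_insert.1 (hD b (Finset.mem_insert_of_mem hb) c hc)).resolve_left ?_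
      rintro rfl
      exact lt_asymm hc (hlt b hb)

lemma length_quotient_pow (n : ℕ) :
    Module.length R (R ⧸ Ideal.span (Set.range x) ^ n) =
      ∑ a ∈ degreeLT d n, Module.length R (R ⧸ leadingIdeal x a) := by
  have hset : {a : Fin d →₀ ℕ | n ≤ a.degree} = (degreeLT d n : Set (Fin d →₀ ℕ))ᶜ := by
    ext a
    simp
  rw [← length_quotient_monomialSpan_compl x, pow_eq_monomialSpan, hset]
  · intro a ha b hb
    rw [mem_degreeLT] at ha ⊢
    exact (Finsupp.DegLex.monotone_degree hb.le).trans_lt ha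

end Length

/-! ### A criterion for the Cohen–Macaulay property -/

section Regular

variable {R : Type*} [CommRing R] {d : ℕ} {x : Fin d → R}

lemma exists_sum_of_mem_monomialSpan (D : Finset (Fin d →₀ ℕ)) {r : R}
    (hr : r ∈ monomialSpan x (D : Set (Fin d →₀ ℕ))) :
    ∃ c : (Fin d →₀ ℕ) → R, ∑ a ∈ D, c a * xpow x a = r :=
  (Submodule.mem_span_image_finset_iff_exists_fun' R).1 hr

lemma mul_xpow_mem_monomialSpan {E : Set (Fin d →₀ ℕ)} {a : Fin d →₀ ℕ}
    (h : ∀ i, a + Finsupp.single i 1 ∈ E) {r : R} (hr : r ∈ Ideal.span (Set.range x)) :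
    r * xpow x a ∈ monomialSpan x E := by
  obtain ⟨c, rfl⟩ := Ideal.mem_span_range_iff_exists_fun.1 hr
  rw [Finset.sum_mul]
  refine sum_mem fun i _ => ?_
  rw [mul_assoc, ← xpow_single x i, ← xpow_add, add_comm]
  exact Ideal.mul_mem_left _ _ (xpow_mem_monomialSpan x (h i))

/-- A sequence all of whose leading ideals are as small as possible is quasi-regular. -/
lemma coeff_mem_of_sum_mem_pow (hx : ∀ a, leadingIdeal x a = Ideal.span (Set.range x)) {n : ℕ}
    {D : Finset (Fin d →₀ ℕ)} (hD : ∀ a ∈ D, a.degree = n) {c : (Fin d →₀ ℕ) → R}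
    (hc : ∑ a ∈ D, c a * xpow x a ∈ Ideal.span (Set.range x) ^ (n + 1)) :
    ∀ a ∈ D, c a ∈ Ideal.span (Set.range x) := by
  classical
  by_contra! hcon
  obtain ⟨a, ha, hmin⟩ := Finset.exists_min_image (D.filter fun a => c a ∉ Ideal.span (Set.range x))
    (toDegLex : (Fin d →₀ ℕ) → _) (by
      obtain ⟨a, ha, hca⟩ := hcon
      exact ⟨a, Finset.mem_filter.2 ⟨ha, hca⟩⟩)
  rw [Finset.mem_filter] at ha
  refine ha.2 ?_
  rw [← hx a, mem_leadingIdeal]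
  have hle : Ideal.span (Set.range x) ^ (n + 1) ≤
      monomialSpan x {b | toDegLex a < toDegLex b} := by
    rw [pow_eq_monomialSpan]
    refine monomialSpan_mono x fun b hb => Finsupp.DegLex.lt_iff.2 (.inl ?_)
    have := hD a ha.1
    simp only [Set.mem_ofPred_eq, ofDegLex_toDegLex] at hb ⊢
    omega
  have h1 : c a * xpow x a = ∑ b ∈ D, c b * xpow x b - ∑ b ∈ D.erase a, c b * xpow x b := by
    rw [← Finset.add_sum_erase _ _ ha.1]; ring
  rw [h1]
  refine sub_mem (hle hc) (sum_mem fun b hb => ?_)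
  obtain ⟨hba, hbD⟩ := Finset.mem_erase.1 hb
  by_cases hcb : c b ∈ Ideal.span (Set.range x)
  · refine hle ?_
    rw [pow_succ', ← hD b hbD]
    exact Ideal.mul_mem_mul hcb (xpow_mem_pow x b)
  · refine Ideal.mul_mem_left _ _ (xpow_mem_monomialSpan x ?_)
    exact lt_of_le_of_ne (hmin b (Finset.mem_filter.2 ⟨hbD, hcb⟩))
      fun h => hba (toDegLex_injective h).symm

/-- The exponents of degree `n` in `E`. -/
noncomputable def degreeEq (E : Set (Fin d →₀ ℕ)) (n : ℕ) : Finset (Fin d →₀ ℕ) :=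
  ((Finsupp.finite_of_degree_eq n).inter_of_left E).toFinset

@[simp]
lemma mem_degreeEq {E : Set (Fin d →₀ ℕ)} {n : ℕ} {a : Fin d →₀ ℕ} :
    a ∈ degreeEq E n ↔ a.degree = n ∧ a ∈ E := by
  simp [degreeEq]

lemma exists_of_mem_monomialSpan {E : Set (Fin d →₀ ℕ)} {n : ℕ} {r : R}
    (hr : r ∈ monomialSpan x (E ∩ {a | n ≤ a.degree})) :
    ∃ c : (Fin d →₀ ℕ) → R, ∃ w ∈ monomialSpan x (E ∩ {a | n + 1 ≤ a.degree}),
      ∑ a ∈ degreeEq E n, c a * xpow x a + w = r := by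
  have h : E ∩ {a | n ≤ a.degree} =
      (degreeEq E n : Set (Fin d →₀ ℕ)) ∪ (E ∩ {a | n + 1 ≤ a.degree}) := by
    ext a
    simp only [Set.mem_inter_iff, Set.mem_ofPred_eq, Set.mem_union, Finset.mem_coe, mem_degreeEq]
    constructor
    · rintro ⟨h1, h2⟩
      rcases h2.eq_or_lt with h | h
      · exact .inl ⟨h.symm, h1⟩
      · exact .inr ⟨h1, h⟩
    · rintro (⟨h1, h2⟩ | ⟨h1, h2⟩)
      · exact ⟨h2, h1.ge⟩
      · exact ⟨h1, by omega⟩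
  rw [h, monomialSpan_union] at hr
  obtain ⟨u, hu, w, hw, huw⟩ := Submodule.mem_sup.1 hr
  obtain ⟨c, rfl⟩ := exists_sum_of_mem_monomialSpan _ hu
  exact ⟨c, w, hw, huw⟩

lemma monomialSpan_inter_le_pow (E : Set (Fin d →₀ ℕ)) (n : ℕ) :
    monomialSpan x (E ∩ {a | n ≤ a.degree}) ≤ Ideal.span (Set.range x) ^ n := by
  rw [pow_eq_monomialSpan]
  exact monomialSpan_mono x Set.inter_subset_right

/-- For a quasi-regular sequence, a monomial ideal meets the powers of `(x)` only in the
combinations of its monomials of the expected degree. -/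
lemma mem_monomialSpan_inter_of_mem_pow
    (hx : ∀ a, leadingIdeal x a = Ideal.span (Set.range x)) {E : Set (Fin d →₀ ℕ)}
    (hE : IsUpperSet E) {r : R} (hr : r ∈ monomialSpan x E) {n : ℕ}
    (hrn : r ∈ Ideal.span (Set.range x) ^ n) :
    r ∈ monomialSpan x (E ∩ {a | n ≤ a.degree}) := by
  induction n with
  | zero => simpa using hr
  | succ n ih =>
    obtain ⟨c, w, hw, hcw⟩ := exists_of_mem_monomialSpan
      (ih (Ideal.pow_le_pow_right n.le_succ hrn))
    have hc := coeff_mem_of_sum_mem_pow hx (D := degreeEq E n) (n := n) (c := c)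
      (fun a ha => (mem_degreeEq.1 ha).1) (by
        rw [eq_sub_of_add_eq hcw]
        exact sub_mem hrn (monomialSpan_inter_le_pow _ _ hw))
    rw [← hcw]
    refine add_mem (sum_mem fun a ha => mul_xpow_mem_monomialSpan (fun i => ?_) (hc a ha)) hw
    rw [mem_degreeEq] at ha
    exact ⟨hE le_self_add ha.2, by simp [ha.1]⟩

/-- For a quasi-regular sequence, `x i` is a nonzerodivisor, up to arbitrarily high powers of `(x)`,
modulo every monomial ideal whose exponents are stable under removing `x i`. -/
lemma mem_monomialSpan_sup_pow_of_mul_mem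
    (hx : ∀ a, leadingIdeal x a = Ideal.span (Set.range x)) {E : Set (Fin d →₀ ℕ)}
    (hE : IsUpperSet E) {i : Fin d} (hi : ∀ a, a + Finsupp.single i 1 ∈ E → a ∈ E) {r : R}
    (hr : x i * r ∈ monomialSpan x E) (n : ℕ) :
    r ∈ monomialSpan x E ⊔ Ideal.span (Set.range x) ^ n := by
  classical
  induction n with
  | zero => simp
  | succ n ih =>
    obtain ⟨s, hs, u, hu, rfl⟩ := Submodule.mem_sup.1 ih
    rw [pow_eq_monomialSpan, ← Set.univ_inter {a : Fin d →₀ ℕ | n ≤ a.degree}] at hu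
    obtain ⟨c, w, hw, rfl⟩ := exists_of_mem_monomialSpan hu
    have hwn := monomialSpan_inter_le_pow _ _ hw
    -- the part of the degree-`n` form that is supported outside `E`
    set D := degreeEq Eᶜ n with hD
    set F := ∑ a ∈ D, c a * xpow x a with hF
    have hsplit : ∑ a ∈ degreeEq Set.univ n, c a * xpow x a =
        ∑ a ∈ degreeEq E n, c a * xpow x a + F := by
      rw [hF, ← Finset.sum_union]
      · congr 1
        ext a
        simp only [mem_degreeEq, Finset.mem_union, hD, Set.mem_univ, Set.mem_compl_iff]
        tauto
      · refine Finset.disjoint_left.2 fun a ha hb => ?_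
        exact (mem_degreeEq.1 hb).2 (mem_degreeEq.1 ha).2
    have hEpart : ∑ a ∈ degreeEq E n, c a * xpow x a ∈ monomialSpan x E :=
      sum_mem fun a ha => Ideal.mul_mem_left _ _ (xpow_mem_monomialSpan x (mem_degreeEq.1 ha).2)
    have hxi : x i ∈ Ideal.span (Set.range x) := Ideal.subset_span ⟨i, rfl⟩
    have hFn : F ∈ Ideal.span (Set.range x) ^ n := sum_mem fun a ha => Ideal.mul_mem_left _ _ (by
      rw [← (mem_degreeEq.1 ha).1]; exact xpow_mem_pow x a)
    have hv : x i * (F + w) ∈ monomialSpan x (E ∩ {a | n + 1 ≤ a.degree}) := by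
      refine mem_monomialSpan_inter_of_mem_pow hx hE ?_ ?_
      · have : x i * (F + w) = x i * (s + (∑ a ∈ degreeEq Set.univ n, c a * xpow x a + w)) -
            x i * (s + ∑ a ∈ degreeEq E n, c a * xpow x a) := by
          rw [hsplit]; ring
        rw [this]
        exact sub_mem hr (Ideal.mul_mem_left _ _ (add_mem hs hEpart))
      · rw [pow_succ']
        exact Ideal.mul_mem_mul hxi (add_mem hFn (Ideal.pow_le_pow_right n.le_succ hwn))
    obtain ⟨c', w', hw', hcw'⟩ := exists_of_mem_monomialSpan hv
    -- compare coefficients of `x i * F` and of a form supported in `E`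
    have hdisj : Disjoint (D.map (addRightEmbedding (Finsupp.single i 1))) (degreeEq E (n + 1)) := by
      refine Finset.disjoint_left.2 fun a ha hb => ?_
      obtain ⟨b, hbD, rfl⟩ := Finset.mem_map.1 ha
      exact (mem_degreeEq.1 hbD).2 (hi b (mem_degreeEq.1 hb).2)
    have hcoef := coeff_mem_of_sum_mem_pow hx (n := n + 1)
      (D := D.map (addRightEmbedding (Finsupp.single i 1)) ∪ degreeEq E (n + 1))
      (c := fun a => if a ∈ degreeEq E (n + 1) then -c' a else c (a - Finsupp.single i 1))
      (fun a ha => by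
        rcases Finset.mem_union.1 ha with ha | ha
        · obtain ⟨b, hbD, rfl⟩ := Finset.mem_map.1 ha
          simp [(mem_degreeEq.1 hbD).1]
        · exact (mem_degreeEq.1 ha).1) (by
        rw [Finset.sum_union hdisj, Finset.sum_map]
        have h1 : ∑ a ∈ D, (if addRightEmbedding (Finsupp.single i 1) a ∈ degreeEq E (n + 1) then
              -c' (addRightEmbedding (Finsupp.single i 1) a) else
              c (addRightEmbedding (Finsupp.single i 1) a - Finsupp.single i 1)) *
            xpow x (addRightEmbedding (Finsupp.single i 1) a) = x i * F := by
          rw [hF, Finset.mul_sum]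
          refine Finset.sum_congr rfl fun a ha => ?_
          rw [if_neg (Finset.disjoint_left.1 hdisj (Finset.mem_map_of_mem _ ha)),
            addRightEmbedding_apply, add_tsub_cancel_right, xpow_add, xpow_single]
          ring
        have h2 : ∑ a ∈ degreeEq E (n + 1), (if a ∈ degreeEq E (n + 1) then -c' a else
              c (a - Finsupp.single i 1)) * xpow x a =
            -∑ a ∈ degreeEq E (n + 1), c' a * xpow x a := by
          rw [← Finset.sum_neg_distrib]
          refine Finset.sum_congr rfl fun a ha => ?_
          rw [if_pos ha, neg_mul]
        rw [h1, h2]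
        have h3 : x i * F + -∑ a ∈ degreeEq E (n + 1), c' a * xpow x a = w' - x i * w := by
          linear_combination -hcw'
        rw [h3]
        refine sub_mem (monomialSpan_inter_le_pow _ _ hw') ?_
        rw [pow_succ']
        exact Ideal.mul_mem_mul hxi hwn)
    have hFq : F ∈ Ideal.span (Set.range x) ^ (n + 1) := by
      refine sum_mem fun a ha => ?_
      have h := hcoef (a + Finsupp.single i 1)
        (Finset.mem_union_left _ (Finset.mem_map_of_mem _ ha))
      have hnot := Finset.disjoint_left.1 hdisj (Finset.mem_map_of_mem _ ha)
      rw [addRightEmbedding_apply] at hnot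
      rw [if_neg hnot, add_tsub_cancel_right] at h
      rw [pow_succ', ← (mem_degreeEq.1 ha).1]
      exact Ideal.mul_mem_mul h (xpow_mem_pow x a)
    rw [hsplit]
    have : s + (∑ a ∈ degreeEq E n, c a * xpow x a + F + w) =
        (s + ∑ a ∈ degreeEq E n, c a * xpow x a) + (F + w) := by ring
    rw [this]
    exact add_mem (Ideal.mem_sup_left (add_mem hs hEpart)) (Ideal.mem_sup_right (add_mem hFq hwn))

end Regular

lemma monomialSpan_exists_lt {R : Type*} [CommRing R] {d : ℕ} (x : Fin d → R) (i : Fin d) :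
    monomialSpan x {a | ∃ j < i, a j ≠ 0} = Ideal.span (x '' {j | j < i}) := by
  refine le_antisymm (Ideal.span_le.2 ?_) (Ideal.span_le.2 ?_)
  · rintro _ ⟨a, ⟨j, hj, haj⟩, rfl⟩
    have : a = a - Finsupp.single j 1 + Finsupp.single j 1 :=
      (tsub_add_cancel_of_le (Finsupp.single_le_iff.2 (Nat.one_le_iff_ne_zero.2 haj))).symm
    rw [this, xpow_add, xpow_single]
    exact Ideal.mul_mem_left _ _ (Ideal.subset_span ⟨j, hj, rfl⟩)
  · rintro _ ⟨j, hj, rfl⟩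
    rw [← xpow_single x j]
    exact xpow_mem_monomialSpan x ⟨j, hj, by simp⟩

section CohenMacaulay

variable {R : Type*} [CommRing R] [IsLocalRing R] [IsNoetherianRing R] {d : ℕ} {x : Fin d → R}

lemma mem_of_forall_mem_sup_pow {I q : Ideal R} (hq : q ≤ maximalIdeal R) {r : R}
    (h : ∀ n : ℕ, r ∈ I ⊔ q ^ n) : r ∈ I := by
  have hbot := Ideal.iInf_pow_smul_eq_bot_of_isLocalRing (M := R ⧸ I) q
    (ne_top_of_le_ne_top Ideal.IsPrime.ne_top' hq)
  have hmem : (Submodule.Quotient.mk r : R ⧸ I) ∈ (⨅ n : ℕ, q ^ n • ⊤ : Submodule R (R ⧸ I)) := by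
    refine (Submodule.mem_iInf _).2 fun n => ?_
    obtain ⟨a, ha, b, hb, rfl⟩ := Submodule.mem_sup.1 (h n)
    have : (Submodule.Quotient.mk (a + b) : R ⧸ I) = b • Submodule.Quotient.mk 1 := by
      rw [Submodule.Quotient.mk_add, (Submodule.Quotient.mk_eq_zero _).2 ha, zero_add,
        ← Submodule.Quotient.mk_smul, smul_eq_mul, mul_one]
    rw [this]
    exact Submodule.smul_mem_smul hb trivial
  rw [hbot] at hmem
  exact (Submodule.Quotient.mk_eq_zero _).1 hmem

lemma isRegular_ofFn_of_leadingIdeal_eq (hm : Ideal.span (Set.range x) ≤ maximalIdeal R)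
    (hx : ∀ a, leadingIdeal x a = Ideal.span (Set.range x)) :
    RingTheory.Sequence.IsRegular R (List.ofFn x) := by
  rw [IsLocalRing.isRegular_iff_isWeaklyRegular_of_subset_maximalIdeal (by
    intro r hr
    obtain ⟨i, rfl⟩ := (List.mem_ofFn' _ _).1 hr
    exact hm (Ideal.subset_span ⟨i, rfl⟩)), RingTheory.Sequence.isWeaklyRegular_iff]
  intro i hi
  have hid : i < d := by simpa using hi
  have hset : {r | r ∈ (List.ofFn x).take i} = x '' {j | j < ⟨i, hid⟩} := by
    ext r
    simp only [List.mem_take_iff_getElem, List.getElem_ofFn, Set.mem_ofPred_eq, Set.mem_image]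
    constructor
    · rintro ⟨j, hj, rfl⟩
      exact ⟨⟨j, by simp at hj; omega⟩, by simp at hj; exact Fin.mk_lt_mk.2 hj.1, rfl⟩
    · rintro ⟨j, hj, rfl⟩
      exact ⟨j, by simpa using Fin.lt_def.1 hj, rfl⟩
  have hI : (Ideal.ofList ((List.ofFn x).take i) • ⊤ : Submodule R R) =
      monomialSpan x {a | ∃ j < (⟨i, hid⟩ : Fin d), a j ≠ 0} := by
    rw [smul_eq_mul, Ideal.mul_top, monomialSpan_exists_lt, ← hset]
  rw [List.getElem_ofFn, hI, isSMulRegular_quotient_iff_mem_of_smul_mem]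
  intro r hr
  refine mem_of_forall_mem_sup_pow hm (mem_monomialSpan_sup_pow_of_mul_mem hx ?_ ?_ hr)
  · rintro a b hab ⟨j, hj, haj⟩
    exact ⟨j, hj, fun h => haj (Nat.le_zero.1 (h ▸ hab j))⟩
  · rintro a ⟨j, hj, haj⟩
    exact ⟨j, hj, by simpa [Finsupp.single_apply, hj.ne'] using haj⟩

lemma isCohenMacaulay_of_isRegular {rs : List R} (hrs : RingTheory.Sequence.IsRegular R rs)
    (hm : ∀ r ∈ rs, r ∈ maximalIdeal R) (hdim : ringKrullDim R = rs.length) :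
    IsCohenMacaulay R := by
  rw [IsCohenMacaulay, hdim]
  have h1 : (rs.length : ℕ∞) ≤ depth R :=
    le_iSup₂_of_le (f := fun (rs : List R) (_ : (∀ r ∈ rs, r ∈ maximalIdeal R) ∧
      RingTheory.Sequence.IsRegular R rs) => (rs.length : ℕ∞)) rs ⟨hm, hrs⟩ le_rfl
  have h2 : depth R ≤ rs.length := by
    refine iSup₂_le fun ss hss => ?_
    have h := ringKrullDim_add_length_eq_ringKrullDim_of_isRegular ss hss.2
    have hnt : Nontrivial (R ⧸ Ideal.ofList ss) := by
      rw [Ideal.Quotient.nontrivial_iff]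
      intro htop
      exact hss.2.top_ne_smul (by rw [htop]; simp)
    have h0 : 0 ≤ ringKrullDim (R ⧸ Ideal.ofList ss) := ringKrullDim_nonneg_of_nontrivial
    rw [hdim] at h
    have h3 : ((ss.length : ℕ∞) : WithBot ℕ∞) ≤ ((rs.length : ℕ∞) : WithBot ℕ∞) := by
      calc ((ss.length : ℕ∞) : WithBot ℕ∞) = 0 + (ss.length : WithBot ℕ∞) := by simp
        _ ≤ ringKrullDim (R ⧸ Ideal.ofList ss) + (ss.length : WithBot ℕ∞) := by gcongr
        _ = _ := by rw [h]; simp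
    exact_mod_cast h3
  rw [le_antisymm h2 h1]
  rfl

end CohenMacaulay

/-! ### The multiplicity -/

lemma mem_of_length_quotient_le {R : Type*} [CommRing R] {I J : Ideal R}
    (hfin : Module.length R (R ⧸ I) ≠ ⊤) (hIJ : I ≤ J)
    (hle : Module.length R (R ⧸ I) ≤ Module.length R (R ⧸ J)) {r : R} (hr : r ∈ J) : r ∈ I := by
  have hsup : I ⊔ Ideal.span {r} ≤ J := sup_le hIJ ((Ideal.span_singleton_le_iff_mem J).2 hr)
  have h1 := hle.trans (Module.length_le_of_surjective (Submodule.factor hsup)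
    (Submodule.factor_surjective _))
  have h2 := length_quotient_eq_add I r
  have hne : Module.length R (R ⧸ I ⊔ Ideal.span {r}) ≠ ⊤ := fun h => hfin (by rw [h2, h]; simp)
  rw [h2] at h1
  have h0 : Module.length R (R ⧸ (Submodule.comap (LinearMap.toSpanSingleton R R r) I :
      Ideal R)) = 0 := by
    rw [← nonpos_iff_eq_zero]
    exact (ENat.add_le_add_iff_right hne).1 (by rwa [zero_add])
  rw [Module.length_eq_zero_iff, Submodule.Quotient.subsingleton_iff] at h0
  have : (1 : R) ∈ Submodule.comap (LinearMap.toSpanSingleton R R r) I := h0 ▸ trivial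
  simpa using this

section Multiplicity

variable {R : Type*} [CommRing R] [IsLocalRing R]

/-- If `𝔪 ^ 2 ⊆ I`, then each generator of `𝔪` modulo `I` contributes at most one to the length of
`R ⧸ I`. -/
lemma length_quotient_le_of_span_eq {I : Ideal R} (hI : maximalIdeal R ^ 2 ≤ I)
    (s : Finset R) (hs : I ⊔ Ideal.span (s : Set R) = maximalIdeal R) :
    Module.length R (R ⧸ I) ≤ s.card + 1 := by
  classical
  induction s using Finset.induction_on generalizing I with
  | empty =>
    have : I = maximalIdeal R := by simpa using hs
    subst this
    have : IsSimpleModule R (R ⧸ maximalIdeal R) :=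
      isSimpleModule_iff_isCoatom.2 (Ideal.isMaximal_def.1 inferInstance)
    rw [Module.length_eq_one]
    simp
  | insert a s ha ih =>
    have ham : a ∈ maximalIdeal R := hs ▸ Ideal.mem_sup_right (Ideal.subset_span (by simp))
    rw [length_quotient_eq_add I a, Finset.card_insert_of_notMem ha, add_comm]
    push_cast
    refine add_le_add ?_ ?_
    · refine ih (hI.trans le_sup_left) ?_
      rw [← hs, Finset.coe_insert, Ideal.span_insert, sup_assoc]
    · have hle : maximalIdeal R ≤ Submodule.comap (LinearMap.toSpanSingleton R R a) I := by
        intro r hr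
        refine hI ?_
        rw [pow_two]
        exact Ideal.mul_mem_mul hr ham
      have : IsSimpleModule R (R ⧸ maximalIdeal R) :=
        isSimpleModule_iff_isCoatom.2 (Ideal.isMaximal_def.1 inferInstance)
      rw [← Module.length_eq_one R (R ⧸ maximalIdeal R)]
      exact Module.length_le_of_surjective (Submodule.factor hle) (Submodule.factor_surjective hle)

end Multiplicity

section Multiplicity

variable {R : Type*} [CommRing R] {d : ℕ} {x : Fin d → R}

lemma length_quotient_leadingIdeal_le (a : Fin d →₀ ℕ) :
    Module.length R (R ⧸ leadingIdeal x a) ≤ Module.length R (R ⧸ Ideal.span (Set.range x)) :=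
  Module.length_le_of_surjective (Submodule.factor (span_le_leadingIdeal x a))
    (Submodule.factor_surjective _)

/-- The limit defining the multiplicity exists and equals the least colength of the leading
ideals. -/
theorem exists_tendsto_hilbertSamuelSeq (hdim : ringKrullDim R = d)
    (hfin : Module.length R (R ⧸ Ideal.span (Set.range x)) ≠ ⊤) :
    ∃ a₀, (∀ a, Module.length R (R ⧸ leadingIdeal x a₀) ≤ Module.length R (R ⧸ leadingIdeal x a)) ∧
      Filter.Tendsto (hilbertSamuelSeq (Ideal.span (Set.range x))) Filter.atTop
        (nhds ((Module.length R (R ⧸ leadingIdeal x a₀)).toNat : ℝ)) := by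
  have hfin' : ∀ a, Module.length R (R ⧸ leadingIdeal x a) ≠ ⊤ := fun a =>
    ne_top_of_le_ne_top hfin (length_quotient_leadingIdeal_le a)
  have hd : natDim R = d := by
    rw [natDim, hdim]
    rfl
  let f : (Fin d →₀ ℕ) → ℕ := fun a => (Module.length R (R ⧸ leadingIdeal x a)).toNat
  have hf : Antitone f := fun a b hab => ENat.toNat_le_toNat
    (Module.length_le_of_surjective (Submodule.factor (leadingIdeal_mono x hab))
      (Submodule.factor_surjective _)) (hfin' a)
  obtain ⟨a₀, ha₀⟩ : ∃ a₀, ∀ a, f a₀ ≤ f a :=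
    ⟨Function.argmin f, fun a => Function.argmin_le f a⟩
  refine ⟨a₀, fun a => ?_, ?_⟩
  · rw [← ENat.natCast_toNat (hfin' a₀), ← ENat.natCast_toNat (hfin' a)]
    exact_mod_cast ha₀ a
  · convert! tendsto_sum_degreeLT hf ha₀ using 2 with n
    rw [hilbertSamuelSeq, hd, length_quotient_pow, ENat.toNat_sum]
    exact fun a _ => hfin' a

end Multiplicity

end AlmostCI

theorem proposition3p6 {R : Type u} [CommRing R] [IsLocalRing R] [IsNoetherianRing R]
    (hR : AlmostCI.IsAlmostCompleteIntersection.{u, v} R)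
    {d : ℕ} (x : Fin d → R) (hx : AlmostCI.IsSystemOfParameters x)
    (hm : maximalIdeal R ^ 2 ≤ Ideal.span (Set.range x))
    (hmin : AlmostCI.IsPartOfMinimalGeneratingSet x (maximalIdeal R)) :
    (AlmostCI.embdim R : WithBot ℕ∞) ≤ ringKrullDim R + 2 ∧
    -- the limit that defines `e(x, R)` exists
    Filter.Tendsto (AlmostCI.hilbertSamuelSeq (Ideal.span (Set.range x))) Filter.atTop
      (nhds (AlmostCI.hilbertSamuelMultiplicity (Ideal.span (Set.range x)))) ∧
    ((AlmostCI.IsCohenMacaulay R ∧ AlmostCI.hilbertSamuelMultiplicity (Ideal.span (Set.range x)) = 3) ∨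
      AlmostCI.hilbertSamuelMultiplicity (Ideal.span (Set.range x)) ≤ 2) := by
  classical
  obtain ⟨A, _, _, 𝔞, ⟨e⟩, h𝔞⟩ := hR
  obtain ⟨hdim, -⟩ := hx
  obtain ⟨k, y, hspan, hirr⟩ := hmin.exists_irredundant
  have hk : k ≤ 2 := by
    let φ : A →+* R := e.symm.toRingHom.comp (Ideal.Quotient.mk 𝔞)
    have hφ : Function.Surjective φ := e.symm.surjective.comp Ideal.Quotient.mk_surjective
    have hker : RingHom.ker φ = 𝔞 := by
      ext a
      simp [φ, RingHom.mem_ker, Ideal.Quotient.eq_zero_iff_mem]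
    exact AlmostCI.card_le_two_of_irredundant φ hφ (by rw [hker, h𝔞]) hdim hm hspan hirr
  have hqm : Ideal.span (Set.range x) ≤ maximalIdeal R := by
    rw [← hspan, Set.Sum.elim_range]
    exact Ideal.span_mono Set.subset_union_left
  have hlen : Module.length R (R ⧸ Ideal.span (Set.range x)) ≤ (3 : ℕ) := by
    refine (AlmostCI.length_quotient_le_of_span_eq hm (Finset.univ.image y) ?_).trans ?_
    · rw [← hspan, Set.Sum.elim_range, Ideal.span_union, Finset.coe_image, Finset.coe_univ,
        Set.image_univ]
    · have := Finset.card_image_le (s := Finset.univ) (f := y)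
      rw [Finset.card_univ, Fintype.card_fin] at this
      exact_mod_cast (by omega : (Finset.univ.image y).card + 1 ≤ 3)
  have hfin : Module.length R (R ⧸ Ideal.span (Set.range x)) ≠ ⊤ :=
    ne_top_of_le_ne_top (ENat.natCast_ne_top 3) hlen
  obtain ⟨a₀, ha₀, hlim⟩ := AlmostCI.exists_tendsto_hilbertSamuelSeq hdim hfin
  have he : AlmostCI.hilbertSamuelMultiplicity (Ideal.span (Set.range x)) =
      ((Module.length R (R ⧸ AlmostCI.leadingIdeal x a₀)).toNat : ℝ) := hlim.limUnder_eq
  refine ⟨?_, he ▸ hlim, ?_⟩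
  · have h := hirr.card_eq_spanFinrank hspan
    rw [AlmostCI.embdim, ← h, hdim]
    simp only [Fintype.card_sum, Fintype.card_fin]
    exact_mod_cast (by omega : d + k ≤ d + 2)
  rw [he]
  have hle := (AlmostCI.length_quotient_leadingIdeal_le (x := x) a₀).trans hlen
  by_cases h3 : Module.length R (R ⧸ AlmostCI.leadingIdeal x a₀) = (3 : ℕ)
  · refine .inl ⟨?_, by rw [h3]; simp⟩
    -- all leading ideals have the same colength as `(x)`, so they are equal to `(x)`
    have hall : ∀ a, AlmostCI.leadingIdeal x a = Ideal.span (Set.range x) := by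
      intro a
      refine le_antisymm (fun r hr => ?_) (AlmostCI.span_le_leadingIdeal x a)
      exact AlmostCI.mem_of_length_quotient_le hfin (AlmostCI.span_le_leadingIdeal x a)
        (hlen.trans (h3.symm.le.trans (ha₀ a))) hr
    refine AlmostCI.isCohenMacaulay_of_isRegular
      (AlmostCI.isRegular_ofFn_of_leadingIdeal_eq hqm hall) ?_ (by simpa using hdim)
    intro r hr
    obtain ⟨i, rfl⟩ := (List.mem_ofFn' _ _).1 hr
    exact hqm (Ideal.subset_span ⟨i, rfl⟩)
  · right
    have h2 : (Module.length R (R ⧸ AlmostCI.leadingIdeal x a₀)).toNat ≤ 2 := by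
      have hne := ne_top_of_le_ne_top (ENat.natCast_ne_top 3) hle
      rw [← ENat.natCast_toNat hne] at hle h3
      norm_cast at hle h3
      omega
    exact_mod_cast h2
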